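/- All graphs are finite, simple and undirected; $N$ denotes the number of nodes, $\mathcal N(v)$ the set of neighbours and $d_v=|\mathcal N(v)|$ the degree of a node $v$, and $\mathrm{relu}(t)=\max(t,0)$ (coordinatewise on vectors). **PG-GNN.** For $n\ge 2$ let $\sigma$ be the permutation of $\{1,\dots,n\}$ that is the cycle $(2\ 4\ 6\cdots n{-}1\ n\ n{-}2\cdots 7\ 5\ 3)$ if $n$ is odd and $(1\ 3\ 5\cdots n{-}1\ n\ n{-}2\cdots 6\ 4\ 2)$ if $n$ is even (the identity for $n\le 1$), and let $\mathfrak G_n=\langle\sigma\rangle$. Number the neighbours of each node $v$ arbitrarily as $u_1,\dots,u_n$ ($n=d_v$) and write $gu_i=u_{g(i)}$. Let $\mathrm{RNN}(x_1,\dots,x_T)=y_T$ be a simple recurrent network, $y_t=\mathrm{relu}(Uy_{t-1}+Wx_t+b)$, with parameters $U,W,b,y_0$. A PG-GNN layer has one of two forms: the separate form $$h_v^{(k)}=\sum_{g\in\mathfrak G_n}\mathrm{RNN}\big(h^{(k-1)}_{gu_1},\dots,h^{(k-1)}_{gu_n},h^{(k-1)}_{gu_1}\big)+W_{\rm self}h_v^{(k-1)},$$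 (the RNN reads the empty sequence if $n=0$), or the merged form $$h_v^{(k)}=\sum_{g\in\mathfrak G_n}\mathrm{RNN}\big(h_v^{(k-1)},h^{(k-1)}_{gu_1},\dots,h^{(k-1)}_{gu_n},h_v^{(k-1)}\big).$$ A PG-GNN consists of finitely many layers of one form; its output at a node is $z_v=\sum_k W^{(k)}h_v^{(k)}$ and its score of a graph is $s=\sum_k W^{(k)}\sum_v h_v^{(k)}$ (sums over all layers, $k=0$ included). *Distinguishable nodes.* The input feature of $v$ is $(d_v, e_{\mathrm{id}(v)})\in\mathbb R^{1+N}$, where $\mathrm{id}$ is a bijection from the nodes to $\{1,\dots,N\}$ and $e_i$ is the $i$-th unit vector. PG-GNN *distinguishes* two graphs $G,G'$ on the same vertex set if there is a choice of depth, dimensions and parameters for which $s(G)\ne s(G')$ for all numberings of neighbours and all bijections $\mathrm{id},\mathrm{id}'$ used on $G$ and $G'$. It distinguishes them *without identifiers* if this holds with every input feature replaced by the constant $1\in\mathbb R$. **$k$-WL.** The $k$-WL test colours the $k$-tuples of nodes, initially by atomic type (which components are equal, which are adjacent); in each iteration the colour of a tuple is refined by the sequence, over $j=1,\dots,k$, of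 the multisets of colours of the tuples obtained by replacing the $j$-th component by each node. It distinguishes $G,G'$ if at some iteration the multisets of the colours of all $k$-tuples differ. It can count a quantity $f$ if it distinguishes any two graphs on the same vertex set with different values of $f$. The WL tests are run on the plain graphs, without node features. **GIN.** A GIN is a finite sequence of layers $h_v\mapsto \mathrm{MLP}^{(k)}\big(h_v+\sum_{u\in\mathcal N(v)}h_u\big)$, each $\mathrm{MLP}^{(k)}$ being a multilayer perceptron with ReLU activations between its affine maps. PG-GNN *simulates* a GIN if for every $N$ and every $B$ some PG-GNN satisfies $z_v={}$(the feature of $v$ computed by the GIN) at every node, for all graphs with node set $\{1,\dots,N\}$, all input features with coordinates in $[-B,B]$, and all numberings of neighbours. For a node $v$ let $\tau_v$ and $\kappa_v$ be the numbers of triangles and of 4-cliques containing $v$. **Proposition.** The following hold for PG-GNNs of each of the two forms, except that the two forms are treated differently in (1). 1. The merged form simulates every GIN. The separate form simulates every GIN whose MLPs each consist of one linear map and a bias. 2. For every finite vertex set there is one PG-GNN which, with distinguishable nodes, outputs $z_v=(\tau_v,\kappa_v)$ at every node $v$ of every graph on this vertex set, for all numberings and identifiers. In contrast, 2-WL can count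 neither $\sum_v\tau_v$ nor $\sum_v\kappa_v$. 3. (Strictly more powerful than 2-WL.) PG-GNN distinguishes any two graphs on the same vertex set that 2-WL distinguishes, even without identifiers; and there are two graphs on the same vertex set which PG-GNN distinguishes and 2-WL does not. 4. (Not less powerful than 3-WL.) The $4\times4$ Rook's graph and the Shrikhande graph are non-isomorphic strongly regular graphs with parameters $(16,6,2,2)$; PG-GNN distinguishes them and the 3-WL test does not. -/

import Mathlib

/-! ### The `k`-dimensional Weisfeiler-Lehman test -/

/-- Colours at iteration `t`. At iteration `0` a colour is an atomic type (which components of the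
tuple are equal, which are adjacent); at iteration `t + 1` it is the previous colour together with,
for each `j`, the multiset of previous colours over the `j`-th neighbourhood. (The injective hash
functions are taken to be identities.) -/
def WLColor (k : ℕ) : ℕ → Type
  | 0 => Fin k → Fin k → Prop × Prop
  | t + 1 => WLColor k t × (Fin k → Multiset (WLColor k t))

/-- The colour given to the tuple `s` at iteration `t`. The `j`-th neighbourhood of `s` is the
multiset of tuples obtained by replacing the `j`-th component by each vertex. -/
def wlColor {V : Type*} [Fintype V] (k : ℕ) (G : SimpleGraph V) :
    (t : ℕ) → (Fin k → V) → WLColor k t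
  | 0, s => fun i j => (s i = s j, G.Adj (s i) (s j))
  | t + 1, s =>
      (wlColor k G t s,
        fun j => (Finset.univ : Finset V).val.map fun u => wlColor k G t (Function.update s j u))

/-- The `k`-WL test tells `G` and `G'` apart: at some iteration the multisets of colours of all
`k`-tuples differ. -/
def WLDistinguishes {V : Type*} [Fintype V] (k : ℕ) (G G' : SimpleGraph V) : Prop :=
  ∃ t : ℕ, (Multiset.map (wlColor k G t) (Finset.univ : Finset (Fin k → V)).val) ≠
    (Multiset.map (wlColor k G' t) (Finset.univ : Finset (Fin k → V)).val)

/-! ### Incidence substructures -/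

/-- The number of neighbours of `v`. -/
noncomputable def nbrCount {V : Type*} (G : SimpleGraph V) (v : V) : ℕ := (G.neighborSet v).ncard

/-- The number of `m`-cliques of `G` containing `v`: incidence triangles over `v` for `m = 3`,
incidence 4-cliques over `v` for `m = 4`. -/
noncomputable def incidenceCliques {V : Type*} (G : SimpleGraph V) (m : ℕ) (v : V) : ℕ :=
  {s : Finset V | v ∈ s ∧ G.IsNClique m s}.ncard

/-- The `k`-WL test can count a graph quantity `f` if it tells apart any two graphs on the same
vertex set on which `f` takes different values. -/
def WLCanCount (k : ℕ) (f : ∀ N : ℕ, SimpleGraph (Fin N) → ℕ) : Prop :=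
  ∀ (N : ℕ) (G G' : SimpleGraph (Fin N)), f N G ≠ f N G' → WLDistinguishes k G G'

/-! ### The permutation group on the neighbours

Indices are `0, …, n - 1` instead of `1, …, n`. -/

/-- In one-based indices: the cycle `(2 4 6 ⋯ n-1 n n-2 ⋯ 7 5 3)` for odd `n`, and the cycle
`(1 3 5 ⋯ n-1 n n-2 ⋯ 6 4 2)` for even `n`. -/
def sigmaVal (n i : ℕ) : ℕ :=
  if n % 2 = 1 then
    if i = 0 then 0
    else if i % 2 = 1 then (if i + 2 < n then i + 2 else i + 1)
    else if i = 2 then 1 else i - 2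
  else
    if i % 2 = 0 then (if i + 2 < n then i + 2 else i + 1)
    else if i = 1 then 0 else i - 2

theorem sigmaVal_lt {n i : ℕ} (h : i < n) : sigmaVal n i < n := by
  unfold sigmaVal
  split_ifs <;> omega

theorem sigmaVal_inj {n i j : ℕ} (hi : i < n) (hj : j < n) (h : sigmaVal n i = sigmaVal n j) :
    i = j := by
  unfold sigmaVal at h
  split_ifs at h <;> omega

/-- The permutation `σ` of the `n` neighbour indices. -/
noncomputable def sigmaPerm (n : ℕ) : Equiv.Perm (Fin n) :=
  Equiv.ofBijective (fun i => ⟨sigmaVal n i, sigmaVal_lt i.2⟩)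
    (Finite.injective_iff_bijective.mp fun i j h =>
      Fin.ext (sigmaVal_inj i.2 j.2 (congrArg Fin.val h)))

open Classical in
/-- The elements of the permutation group generated by `σ`. -/
noncomputable def pgGroup (n : ℕ) : Finset (Equiv.Perm (Fin n)) :=
  Finset.univ.filter fun g => g ∈ Subgroup.zpowers (sigmaPerm n)

/-! ### Networks -/

/-- The rectified linear unit, applied coordinatewise. -/
noncomputable def reluVec {d : ℕ} (x : Fin d → ℝ) : Fin d → ℝ := fun i => max (x i) 0

/-- Parameters of a simple recurrent network with inputs in `ℝ^d` and states in `ℝ^e`. -/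
structure SRN (d e : ℕ) where
  /-- recurrent weights -/
  U : Matrix (Fin e) (Fin e) ℝ
  /-- input weights -/
  W : Matrix (Fin e) (Fin d) ℝ
  /-- bias -/
  b : Fin e → ℝ
  /-- initial state -/
  y0 : Fin e → ℝ

/-- The final state after reading a sequence: `y_t = relu (U y_{t-1} + W x_t + b)`. -/
noncomputable def SRN.run {d e : ℕ} (R : SRN d e) (l : List (Fin d → ℝ)) : Fin e → ℝ :=
  l.foldl (fun y x => reluVec (R.U.mulVec y + R.W.mulVec x + R.b)) R.y0

/-- The two forms of the aggregation: the central node enters through a separate linear term, or it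
is merged into the sequence read by the recurrent network. -/
inductive PGForm
  | separate
  | merged

/-- Parameters of one layer. -/
inductive PGLayer : PGForm → ℕ → ℕ → Type
  | separate {d e : ℕ} (R : SRN d e) (Wself : Matrix (Fin e) (Fin d) ℝ) : PGLayer .separate d e
  | merged {d e : ℕ} (R : SRN d e) : PGLayer .merged d e

/-- A numbering `u_1, …, u_n` of the neighbours of every node. -/
abbrev NbrNumbering {V : Type*} (G : SimpleGraph V) : Type _ :=
  ∀ v : V, Fin (nbrCount G v) ≃ G.neighborSet v

/-- The sequence `h_{g u_1}, …, h_{g u_n}` of features of the neighbours of `v`. -/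
noncomputable def nbrSeq {V : Type*} {G : SimpleGraph V} (ν : NbrNumbering G) {d : ℕ} (h : V → Fin d → ℝ) (v : V)
    (g : Equiv.Perm (Fin (nbrCount G v))) : List (Fin d → ℝ) :=
  List.ofFn fun i => h (ν v (g i))

/-- One layer.
* separate form: `∑_g RNN(h_{g u_1}, …, h_{g u_n}, h_{g u_1}) + Wself h_v`;
* merged form: `∑_g RNN(h_v, h_{g u_1}, …, h_{g u_n}, h_v)`. -/
noncomputable def PGLayer.apply {V : Type*} {G : SimpleGraph V} (ν : NbrNumbering G) {F : PGForm}
    {d e : ℕ} (L : PGLayer F d e) (h : V → Fin d → ℝ) (v : V) : Fin e → ℝ :=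
  match L with
  | .separate R Wself =>
      (∑ g ∈ pgGroup (nbrCount G v), R.run (nbrSeq ν h v g ++ (nbrSeq ν h v g).take 1))
        + Wself.mulVec (h v)
  | .merged R => ∑ g ∈ pgGroup (nbrCount G v), R.run (h v :: (nbrSeq ν h v g ++ [h v]))

/-- A PG-GNN with inputs in `ℝ^d` and scores in `ℝ^C`: any number of layers, with a scoring
matrix for the features of each layer (the input features included). -/
inductive PGGNN (F : PGForm) (C : ℕ) : ℕ → Type
  | last {d : ℕ} (W : Matrix (Fin C) (Fin d) ℝ) : PGGNN F C d
  | cons {d e : ℕ} (W : Matrix (Fin C) (Fin d) ℝ) (L : PGLayer F d e) (rest : PGGNN F C e) :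
      PGGNN F C d

/-- The output at a node, `z_v = ∑_k W^(k) h_v^(k)`. -/
noncomputable def PGGNN.nodeScore {V : Type*} {G : SimpleGraph V} (ν : NbrNumbering G) {F : PGForm}
    {C : ℕ} : {d : ℕ} → PGGNN F C d → (V → Fin d → ℝ) → V → Fin C → ℝ
  | _, .last W, h, v => W.mulVec (h v)
  | _, .cons W L rest, h, v => W.mulVec (h v) + rest.nodeScore ν (L.apply ν h) v

/-- The score of the graph, `s = ∑_k W^(k) h_G^(k)` with `h_G^(k) = ∑_v h_v^(k)`. -/
noncomputable def PGGNN.graphScore {V : Type*} [Fintype V] {G : SimpleGraph V} (ν : NbrNumbering G)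
    {F : PGForm} {C : ℕ} : {d : ℕ} → PGGNN F C d → (V → Fin d → ℝ) → Fin C → ℝ
  | _, .last W, h => W.mulVec (∑ v, h v)
  | _, .cons W L rest, h => W.mulVec (∑ v, h v) + rest.graphScore ν (L.apply ν h)

/-- Input features with distinguishable nodes: the degree of the node, followed by a one-hot
identifier. -/
noncomputable def identifiedInput {V : Type*} [Fintype V] (G : SimpleGraph V)
    (ident : V ≃ Fin (Fintype.card V)) (v : V) : Fin (Fintype.card V + 1) → ℝ :=
  Fin.cons (nbrCount G v : ℝ) (Pi.single (ident v) 1)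

/-- PG-GNNs of the given form can tell `G` and `G'` apart: for some choice of the parameters the
scores of `G` and `G'` differ, whichever numberings of neighbours and whichever assignments of
identifiers are used on the two graphs. -/
def PGDistinguishes {V : Type*} [Fintype V] (F : PGForm) (G G' : SimpleGraph V) : Prop :=
  ∃ (C : ℕ) (net : PGGNN F C (Fintype.card V + 1)),
    ∀ (ν : NbrNumbering G) (ν' : NbrNumbering G') (ident ident' : V ≃ Fin (Fintype.card V)),
      net.graphScore ν (identifiedInput G ident) ≠ net.graphScore ν' (identifiedInput G' ident')

/-- The same without identifiers: all nodes of both graphs have the same constant input feature. -/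
def PGDistinguishesAnonymous {V : Type*} [Fintype V] (F : PGForm) (G G' : SimpleGraph V) : Prop :=
  ∃ (C : ℕ) (net : PGGNN F C 1), ∀ (ν : NbrNumbering G) (ν' : NbrNumbering G'),
    net.graphScore ν (fun _ _ => 1) ≠ net.graphScore ν' (fun _ _ => 1)

/-! ### GIN -/

/-- A multilayer perceptron with ReLU activations between its affine maps. -/
inductive MLP : ℕ → ℕ → Type
  | affine {d e : ℕ} (W : Matrix (Fin e) (Fin d) ℝ) (b : Fin e → ℝ) : MLP d e
  | hidden {d m e : ℕ} (W : Matrix (Fin m) (Fin d) ℝ) (b : Fin m → ℝ) (rest : MLP m e) : MLP d e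

/-- The function computed by a perceptron. -/
noncomputable def MLP.eval : {d e : ℕ} → MLP d e → (Fin d → ℝ) → Fin e → ℝ
  | _, _, .affine W b, x => W.mulVec x + b
  | _, _, .hidden W b rest, x => rest.eval (reluVec (W.mulVec x + b))

/-- The perceptron consists of one linear map and a bias. -/
def MLP.IsAffine {d e : ℕ} : MLP d e → Prop
  | .affine _ _ => True
  | .hidden _ _ _ => False

/-- A GIN: a sequence of perceptrons, one for each layer. -/
inductive GIN (e : ℕ) : ℕ → Type
  | nil : GIN e e
  | cons {d m : ℕ} (M : MLP d m) (rest : GIN e m) : GIN e d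

open Classical in
/-- The node features computed by a GIN, with layers `h_v ↦ MLP (h_v + ∑_{u ∈ N(v)} h_u)`. -/
noncomputable def GIN.features {V : Type*} [Fintype V] (G : SimpleGraph V) {e : ℕ} :
    {d : ℕ} → GIN e d → (V → Fin d → ℝ) → V → Fin e → ℝ
  | _, .nil, h => h
  | _, .cons M rest, h =>
      rest.features G fun v => M.eval (h v + ∑ u ∈ G.neighborFinset v, h u)

/-- All perceptrons of the GIN consist of one linear map and a bias. -/
def GIN.IsAffine {e : ℕ} : {d : ℕ} → GIN e d → Prop
  | _, .nil => True
  | _, .cons M rest => M.IsAffine ∧ rest.IsAffine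

/-- PG-GNNs of the given form simulate the GIN `gin`: on every finite vertex set and for every
bound on the input features, one PG-GNN computes the same node features as `gin`, on all graphs on
this vertex set, for all inputs within the bound and all numberings of the neighbours. -/
def PGSimulates (F : PGForm) {d e : ℕ} (gin : GIN e d) : Prop :=
  ∀ (N : ℕ) (B : ℝ), ∃ net : PGGNN F e d,
    ∀ (G : SimpleGraph (Fin N)) (ν : NbrNumbering G) (x : Fin N → Fin d → ℝ),
      (∀ v i, |x v i| ≤ B) → ∀ v, net.nodeScore ν x v = gin.features G x v

/-! ### The two strongly regular graphs -/

/-- The 4×4 Rook's graph: distinct squares in a common row or column. -/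
def rookGraph : SimpleGraph (ZMod 4 × ZMod 4) where
  Adj a b := a ≠ b ∧ (a.1 = b.1 ∨ a.2 = b.2)
  symm := ⟨fun _ _ h => ⟨h.1.symm, h.2.imp Eq.symm Eq.symm⟩⟩
  loopless := ⟨fun _ h => h.1 rfl⟩

/-- The Shrikhande graph: the Cayley graph of `ℤ/4 × ℤ/4` with connection set
`±(1,0), ±(0,1), ±(1,1)`. -/
def shrikhandeGraph : SimpleGraph (ZMod 4 × ZMod 4) where
  Adj a b := b - a ∈ ({(1, 0), (3, 0), (0, 1), (0, 3), (1, 1), (3, 3)} : Finset (ZMod 4 × ZMod 4))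
  symm := ⟨by decide⟩
  loopless := ⟨by decide⟩

instance : DecidableRel rookGraph.Adj := fun a b =>
  inferInstanceAs (Decidable (a ≠ b ∧ (a.1 = b.1 ∨ a.2 = b.2)))

instance : DecidableRel shrikhandeGraph.Adj := fun a b =>
  inferInstanceAs (Decidable (b - a ∈
    ({(1, 0), (3, 0), (0, 1), (0, 3), (1, 1), (3, 3)} : Finset (ZMod 4 × ZMod 4))))

/-!
All constructions rest on one device. A recurrent network can count its steps in one-hot
coordinates, so that at its last step it knows the degree `k` of the central node. Subtracting a
large constant from all output coordinates but the one belonging to `k` (`Recurrence.gated`), the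
layer can divide the output by the order of the permutation group on `k` neighbours. If the output
does not depend on the order in which the neighbours are read, the sum over the group then equals
the output for a single order. The only property of the permutation group that is needed is that it
is not empty. In the merged form the first step is used to reset the state, after which both forms
read the sequence of neighbours from the state `0`. The outcome is
`Recurrence.ReadsNbrs.realizes`: both forms realize every order-independent linear readout of a
recurrence on the neighbours, plus an affine function of the central node.

The recurrences used are prefix sums (`Recurrence.prefixSum`): a message is computed from the
current neighbour and the sum of the vectors of the neighbours read before. Without the dependence
on the prefix they give ordinary message passing with rectified messages and a linear self-term. This
suffices for GINs with affine perceptrons. The merged form can in addition apply the rectifier to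
the features of the central node, which it reads last, and so evaluates arbitrary perceptrons.

With identifiers, the prefix is the set of neighbours read so far. After one round every node knows
the identifiers of its neighbours. In the next round a node finds each edge between two of its
neighbours when the second end is read (`CliqueNet.prefixSum_edge`), and in the third round each
triangle among its neighbours when the last vertex is read (`CliqueNet.prefixSum_triangle`).

For 2-WL, message passing with messages `(N + 1) ^ c` for natural numbers `c` as colours refines the
colouring as colour refinement does; a computable colouring with the greatest number of classes is
therefore equitable (`Refinement.exists_equitable`). A rectified message can realize every function
of finitely many colours, and a sum over all nodes of sums over their neighbours weights the colours
by degrees, which are themselves functions of the colours. If the scores of two graphs never differ,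
their colour histograms agree, and two equitable colourings with the same histogram give a winning
strategy in the bijective pebble game for 2-WL (`not_WLDistinguishes_two_of_equitable`). Regular
graphs of the same degree are thus not distinguished by 2-WL, and strongly regular graphs with the
same parameters are not distinguished by 3-WL (`not_WLDistinguishes_three_of_isSRGWith`). In the
separating pairs, one graph has a 4-clique and the other has none.
-/

open scoped Matrix

/-! ### Stacks of layers and realizable node functionals -/

theorem SRN.run_mul {d m e : ℕ} (R : SRN m e) (M : Matrix (Fin m) (Fin d) ℝ)
    (l : List (Fin d → ℝ)) :
    SRN.run ⟨R.U, R.W * M, R.b, R.y0⟩ l = R.run (l.map fun x => M *ᵥ x) := by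
  simp [SRN.run, List.foldl_map, Matrix.mulVec_mulVec]

/-- The layer that first applies the matrix `M` to all features. -/
def PGLayer.precomp {F : PGForm} {d m e : ℕ} (L : PGLayer F m e) (M : Matrix (Fin m) (Fin d) ℝ) :
    PGLayer F d e :=
  match L with
  | .separate R Wself => .separate ⟨R.U, R.W * M, R.b, R.y0⟩ (Wself * M)
  | .merged R => .merged ⟨R.U, R.W * M, R.b, R.y0⟩

theorem PGLayer.precomp_apply {V : Type*} {G : SimpleGraph V} (ν : NbrNumbering G) {F : PGForm}
    {d m e : ℕ} (L : PGLayer F m e) (M : Matrix (Fin m) (Fin d) ℝ) (h : V → Fin d → ℝ) :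
    (L.precomp M).apply ν h = L.apply ν fun v => M *ᵥ h v := by
  have key : ∀ v g, nbrSeq ν (fun v => M *ᵥ h v) v g = (nbrSeq ν h v g).map fun x => M *ᵥ x := by
    intro v g
    simp [nbrSeq, List.map_ofFn, Function.comp_def]
  funext v
  cases L with
  | separate R Wself =>
    simp [PGLayer.precomp, PGLayer.apply, SRN.run_mul, key, Matrix.mulVec_mulVec, List.map_take]
  | merged R =>
    simp [PGLayer.precomp, PGLayer.apply, SRN.run_mul, key]

/-- A finite sequence of layers, without scoring matrices. -/
inductive PGStack (F : PGForm) : ℕ → ℕ → Type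
  | nil {d : ℕ} : PGStack F d d
  | cons {d m e : ℕ} (L : PGLayer F d m) (S : PGStack F m e) : PGStack F d e

namespace PGStack

/-- The features after the last layer. -/
noncomputable def apply {V : Type*} {G : SimpleGraph V} (ν : NbrNumbering G) {F : PGForm} :
    {d e : ℕ} → PGStack F d e → (V → Fin d → ℝ) → V → Fin e → ℝ
  | _, _, nil, h => h
  | _, _, cons L S, h => S.apply ν (L.apply ν h)

/-- Concatenation of two stacks. -/
def append {F : PGForm} : {d m e : ℕ} → PGStack F d m → PGStack F m e → PGStack F d e
  | _, _, _, nil, T => T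
  | _, _, _, cons L S, T => cons L (S.append T)

theorem append_apply {V : Type*} {G : SimpleGraph V} (ν : NbrNumbering G) {F : PGForm}
    {d m e : ℕ} (S : PGStack F d m) (T : PGStack F m e) (h : V → Fin d → ℝ) :
    (S.append T).apply ν h = T.apply ν (S.apply ν h) := by
  induction S with
  | nil => rfl
  | cons L S ih => exact ih T _

/-- The network that scores only the features after the last layer. -/
def toNet {F : PGForm} {C : ℕ} : {d e : ℕ} → PGStack F d e → Matrix (Fin C) (Fin e) ℝ → PGGNN F C d
  | _, _, nil, W => .last W
  | _, _, cons L S, W => .cons 0 L (S.toNet W)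

theorem toNet_nodeScore {V : Type*} {G : SimpleGraph V} (ν : NbrNumbering G) {F : PGForm} {C : ℕ}
    {d e : ℕ} (S : PGStack F d e) (W : Matrix (Fin C) (Fin e) ℝ) (h : V → Fin d → ℝ) (v : V) :
    (S.toNet W).nodeScore ν h v = W *ᵥ S.apply ν h v := by
  induction S with
  | nil => rfl
  | cons L S ih => simp [toNet, PGGNN.nodeScore, ih, apply]

end PGStack

/-- The scoring matrices are linear, so the score of the graph is the sum of the node scores. -/
theorem PGGNN.graphScore_eq_sum {V : Type*} [Fintype V] {G : SimpleGraph V} (ν : NbrNumbering G)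
    {F : PGForm} {C d : ℕ} (net : PGGNN F C d) (h : V → Fin d → ℝ) :
    net.graphScore ν h = ∑ v, net.nodeScore ν h v := by
  have hW : ∀ {d : ℕ} (W : Matrix (Fin C) (Fin d) ℝ) (h : V → Fin d → ℝ),
      W *ᵥ (∑ v, h v) = ∑ v, W *ᵥ h v := fun W h => map_sum W.mulVecLin h _
  induction net with
  | last W => exact hW W h
  | cons W L rest ih =>
    simp only [PGGNN.graphScore, PGGNN.nodeScore, Finset.sum_add_distrib, ih, hW]

/-- Networks of the form `F` realize the functional `Φ` on the domain `D` of graphs with features: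
between two linear maps, some stack of layers computes `Φ` whatever the numberings of the
neighbours are. Features are indexed by arbitrary finite types; the linear maps take care of the
reindexing. -/
def Realizes (F : PGForm) {V κ ι : Type} [Fintype κ] (D : SimpleGraph V → (V → κ → ℝ) → Prop)
    (Φ : SimpleGraph V → (V → κ → ℝ) → V → ι → ℝ) : Prop :=
  ∃ (d e : ℕ) (A : Matrix (Fin d) κ ℝ) (S : PGStack F d e) (B : Matrix ι (Fin e) ℝ),
    ∀ (G : SimpleGraph V) (ν : NbrNumbering G) (h : V → κ → ℝ), D G h →
      ∀ v, B *ᵥ S.apply ν (fun w => A *ᵥ h w) v = Φ G h v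

namespace Realizes

variable {F : PGForm} {V κ ι ρ : Type} [Fintype κ]
  {D : SimpleGraph V → (V → κ → ℝ) → Prop}

theorem linear (f : (κ → ℝ) →ₗ[ℝ] (ι → ℝ)) : Realizes F D fun _ h v => f (h v) := by
  classical
  let e := Fintype.equivFin κ
  refine ⟨_, _, (1 : Matrix κ κ ℝ).submatrix e.symm id, .nil,
    (LinearMap.toMatrix' f).submatrix id e.symm, fun G ν h _ v => ?_⟩
  rw [PGStack.apply, Matrix.mulVec_mulVec, Matrix.submatrix_mul_equiv]
  simp [LinearMap.toMatrix'_mulVec]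

theorem congr {Φ Ψ : SimpleGraph V → (V → κ → ℝ) → V → ι → ℝ} (hΦ : Realizes F D Φ)
    (h : ∀ G h, D G h → Φ G h = Ψ G h) : Realizes F D Ψ := by
  obtain ⟨d, e, A, S, B, hS⟩ := hΦ
  exact ⟨d, e, A, S, B, fun G ν x hx v => by rw [hS G ν x hx v, h G x hx]⟩

theorem comp [Fintype ι] {D' : SimpleGraph V → (V → ι → ℝ) → Prop}
    {Ψ : SimpleGraph V → (V → ι → ℝ) → V → ρ → ℝ}
    {Φ : SimpleGraph V → (V → κ → ℝ) → V → ι → ℝ} (hΨ : Realizes F D' Ψ) (hΦ : Realizes F D Φ)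
    (hD : ∀ G h, D G h → D' G (Φ G h)) : Realizes F D fun G h => Ψ G (Φ G h) := by
  obtain ⟨d, e, A, S, B, hS⟩ := hΦ
  obtain ⟨d', e', A', S', B', hS'⟩ := hΨ
  have key : ∀ G (ν : NbrNumbering G) h, D G h →
      Φ G h = fun v => B *ᵥ S.apply ν (fun w => A *ᵥ h w) v :=
    fun G ν h hh => funext fun v => (hS G ν h hh v).symm
  cases S' with
  | nil =>
    refine ⟨d, e, A, S, B' * (A' * B), fun G ν h hh v => ?_⟩
    beta_reduce
    rw [← hS' G ν _ (hD G h hh) v, key G ν h hh]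
    simp [PGStack.apply, Matrix.mulVec_mulVec]
  | cons L T =>
    refine ⟨d, e', A, S.append (.cons (L.precomp (A' * B)) T), B', fun G ν h hh v => ?_⟩
    beta_reduce
    rw [← hS' G ν _ (hD G h hh) v, key G ν h hh]
    simp [PGStack.apply, PGStack.append_apply, PGLayer.precomp_apply, Matrix.mulVec_mulVec]

theorem linear_comp [Fintype ι] {Φ : SimpleGraph V → (V → κ → ℝ) → V → ι → ℝ}
    (hΦ : Realizes F D Φ) (f : (ι → ℝ) →ₗ[ℝ] (ρ → ℝ)) : Realizes F D fun G h v => f (Φ G h v) :=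
  (linear (D := fun _ _ => True) f).comp hΦ fun _ _ _ => trivial

theorem exists_net {d C : ℕ} {D : SimpleGraph V → (V → Fin d → ℝ) → Prop}
    {Φ : SimpleGraph V → (V → Fin d → ℝ) → V → Fin C → ℝ} (hΦ : Realizes F D Φ) :
    ∃ net : PGGNN F C d, ∀ (G : SimpleGraph V) (ν : NbrNumbering G) (h : V → Fin d → ℝ), D G h →
      ∀ v, net.nodeScore ν h v = Φ G h v := by
  obtain ⟨d, e, A, S, B, hS⟩ := hΦ
  cases S with
  | nil =>
    refine ⟨.last (B * A), fun G ν h hh v => ?_⟩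
    rw [← hS G ν h hh v]
    simp [PGGNN.nodeScore, PGStack.apply, Matrix.mulVec_mulVec]
  | cons L T =>
    refine ⟨.cons 0 (L.precomp A) (T.toNet B), fun G ν h hh v => ?_⟩
    rw [← hS G ν h hh v]
    simp [PGGNN.nodeScore, PGStack.apply, PGStack.toNet_nodeScore, PGLayer.precomp_apply]

end Realizes

/-! ### Recurrences as layers -/

/-- The neighbours of `v` in some order. -/
def IsNbrList {V : Type*} (G : SimpleGraph V) (v : V) (l : List V) : Prop :=
  l.Nodup ∧ ∀ u, u ∈ l ↔ G.Adj v u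

theorem nbrSeq_eq_map {V : Type*} {G : SimpleGraph V} (ν : NbrNumbering G) (v : V)
    (g : Equiv.Perm (Fin (nbrCount G v))) : ∃ l : List V, IsNbrList G v l ∧
      l.length = nbrCount G v ∧ ∀ {d : ℕ} (h : V → Fin d → ℝ), nbrSeq ν h v g = l.map h := by
  refine ⟨List.ofFn fun i => ν v (g i), ⟨?_, fun u => ?_⟩, by simp, fun h => ?_⟩
  · rw [List.nodup_ofFn]
    exact Subtype.val_injective.comp ((ν v).injective.comp g.injective)
  · rw [List.mem_ofFn]
    constructor
    · rintro ⟨i, rfl⟩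
      exact (ν v (g i)).2
    · intro hu
      exact ⟨g.symm ((ν v).symm ⟨u, hu⟩), by simp⟩
  · simp [nbrSeq, List.map_ofFn, Function.comp_def]

theorem card_pgGroup_pos (n : ℕ) : 0 < (pgGroup n).card :=
  Finset.card_pos.mpr ⟨1, by simp [pgGroup]⟩

/-- A simple recurrent network without initial state, whose inputs and states are indexed by
arbitrary types. -/
structure Recurrence (κ ε : Type) where
  /-- recurrent weights -/
  U : (ε → ℝ) →ₗ[ℝ] (ε → ℝ)
  /-- input weights -/
  W : (κ → ℝ) →ₗ[ℝ] (ε → ℝ)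
  /-- bias -/
  b : ε → ℝ

namespace Recurrence

variable {κ ε ι : Type}

/-- The next state before rectification. -/
def pre (R : Recurrence κ ε) (y : ε → ℝ) (x : κ → ℝ) : ε → ℝ := R.U y + R.W x + R.b

/-- One step of the recurrence. -/
noncomputable def step (R : Recurrence κ ε) (y : ε → ℝ) (x : κ → ℝ) : ε → ℝ :=
  fun i => max (R.pre y x i) 0

/-- The final state after reading a sequence, from the initial state `y`. -/
noncomputable def run (R : Recurrence κ ε) (y : ε → ℝ) (l : List (κ → ℝ)) : ε → ℝ :=
  l.foldl R.step y

open Classical in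
/-- The same network with numbered coordinates. -/
noncomputable def toSRN [Fintype κ] [Fintype ε] (R : Recurrence κ ε) (y : ε → ℝ) :
    SRN (Fintype.card κ) (Fintype.card ε) where
  U := (LinearMap.toMatrix' R.U).submatrix (Fintype.equivFin ε).symm (Fintype.equivFin ε).symm
  W := (LinearMap.toMatrix' R.W).submatrix (Fintype.equivFin ε).symm (Fintype.equivFin κ).symm
  b := R.b ∘ (Fintype.equivFin ε).symm
  y0 := y ∘ (Fintype.equivFin ε).symm

theorem toSRN_run [Fintype κ] [Fintype ε] (R : Recurrence κ ε) (y : ε → ℝ) (l : List (κ → ℝ)) :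
    (R.toSRN y).run (l.map fun x => x ∘ (Fintype.equivFin κ).symm) =
      R.run y l ∘ (Fintype.equivFin ε).symm := by
  unfold SRN.run run
  change List.foldl _ (y ∘ (Fintype.equivFin ε).symm) _ = _
  induction l generalizing y with
  | nil => rfl
  | cons x l ih =>
    rw [List.map_cons, List.foldl_cons, List.foldl_cons, ← ih]
    congr 1
    funext i
    simp [toSRN, reluVec, step, pre, Matrix.submatrix_mulVec_equiv, Function.comp_assoc,
      LinearMap.toMatrix'_mulVec]

variable {V : Type} [Fintype κ] [Fintype ε]
  {D : SimpleGraph V → (V → κ → ℝ) → Prop}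

/-- A recurrence whose readout does not depend on the order of the neighbours, and is divided by
the order of the permutation group, gives a layer of the merged form. -/
theorem realizes_merged (R : Recurrence κ ε) (y : ε → ℝ)
    (f : (ε → ℝ) →ₗ[ℝ] (ι → ℝ)) {Φ : SimpleGraph V → (V → κ → ℝ) → V → ι → ℝ}
    (hΦ : ∀ G h, D G h → ∀ v l, IsNbrList G v l →
      f (R.run y (h v :: (l.map h ++ [h v]))) = ((pgGroup l.length).card : ℝ)⁻¹ • Φ G h v) :
    Realizes .merged D Φ := by
  classical
  refine ⟨_, _, (1 : Matrix κ κ ℝ).submatrix (Fintype.equivFin κ).symm id,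
    .cons (.merged (R.toSRN y)) .nil,
    (LinearMap.toMatrix' f).submatrix id (Fintype.equivFin ε).symm, fun G ν h hh v => ?_⟩
  have h1 : (fun w => ((1 : Matrix κ κ ℝ).submatrix (Fintype.equivFin κ).symm id) *ᵥ h w) =
      fun w => h w ∘ (Fintype.equivFin κ).symm := by
    funext w i
    simp [Matrix.mulVec, dotProduct, Matrix.one_apply]
  have h2 : ∀ x : ε → ℝ, (LinearMap.toMatrix' f).submatrix id (Fintype.equivFin ε).symm *ᵥ
      (x ∘ (Fintype.equivFin ε).symm) = f x := fun x => by
    simp [Matrix.submatrix_mulVec_equiv, Function.comp_assoc, LinearMap.toMatrix'_mulVec]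
  rw [h1]
  simp only [PGStack.apply, PGLayer.apply, Matrix.mulVec_sum]
  have h3 : ∀ g ∈ pgGroup (nbrCount G v), (LinearMap.toMatrix' f).submatrix id
      (Fintype.equivFin ε).symm *ᵥ (R.toSRN y).run ((h v ∘ (Fintype.equivFin κ).symm) ::
        (nbrSeq ν (fun w => h w ∘ (Fintype.equivFin κ).symm) v g ++
          [h v ∘ (Fintype.equivFin κ).symm])) =
      ((pgGroup (nbrCount G v)).card : ℝ)⁻¹ • Φ G h v := by
    intro g _
    obtain ⟨l, hl, hlen, hs⟩ := nbrSeq_eq_map ν v g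
    have := R.toSRN_run y (h v :: (l.map h ++ [h v]))
    rw [List.map_cons, List.map_append, List.map_map, List.map_singleton] at this
    rw [hs, Function.comp_def] at *
    erw [this]
    rw [h2, hΦ G h hh v l hl, hlen]
  rw [Finset.sum_congr rfl h3, Finset.sum_const, ← Nat.cast_smul_eq_nsmul ℝ, smul_smul,
    mul_inv_cancel₀ (by exact_mod_cast (card_pgGroup_pos _).ne'), one_smul]

/-- A recurrence whose readout does not depend on the order of the neighbours, and is divided by
the order of the permutation group, gives a layer of the separate form. -/
theorem realizes_separate (R : Recurrence κ ε) (y : ε → ℝ)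
    (f : (ε → ℝ) →ₗ[ℝ] (ι → ℝ)) (A : (κ → ℝ) →ₗ[ℝ] (ε → ℝ))
    {Φ : SimpleGraph V → (V → κ → ℝ) → V → ι → ℝ}
    (hΦ : ∀ G h, D G h → ∀ v l, IsNbrList G v l →
      f (R.run y (l.map h ++ (l.map h).take 1)) = ((pgGroup l.length).card : ℝ)⁻¹ • Φ G h v) :
    Realizes .separate D fun G h v => Φ G h v + f (A (h v)) := by
  classical
  refine ⟨_, _, (1 : Matrix κ κ ℝ).submatrix (Fintype.equivFin κ).symm id,
    .cons (.separate (R.toSRN y) ((LinearMap.toMatrix' A).submatrix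
      (Fintype.equivFin ε).symm (Fintype.equivFin κ).symm)) .nil,
    (LinearMap.toMatrix' f).submatrix id (Fintype.equivFin ε).symm, fun G ν h hh v => ?_⟩
  have h1 : (fun w => ((1 : Matrix κ κ ℝ).submatrix (Fintype.equivFin κ).symm id) *ᵥ h w) =
      fun w => h w ∘ (Fintype.equivFin κ).symm := by
    funext w i
    simp [Matrix.mulVec, dotProduct, Matrix.one_apply]
  have h2 : ∀ x : ε → ℝ, (LinearMap.toMatrix' f).submatrix id (Fintype.equivFin ε).symm *ᵥ
      (x ∘ (Fintype.equivFin ε).symm) = f x := fun x => by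
    simp [Matrix.submatrix_mulVec_equiv, Function.comp_assoc, LinearMap.toMatrix'_mulVec]
  rw [h1]
  simp only [PGStack.apply, PGLayer.apply, Matrix.mulVec_sum, Matrix.mulVec_add]
  have h3 : ∀ g ∈ pgGroup (nbrCount G v), (LinearMap.toMatrix' f).submatrix id
      (Fintype.equivFin ε).symm *ᵥ (R.toSRN y).run
        (nbrSeq ν (fun w => h w ∘ (Fintype.equivFin κ).symm) v g ++
          (nbrSeq ν (fun w => h w ∘ (Fintype.equivFin κ).symm) v g).take 1) =
      ((pgGroup (nbrCount G v)).card : ℝ)⁻¹ • Φ G h v := by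
    intro g _
    obtain ⟨l, hl, hlen, hs⟩ := nbrSeq_eq_map ν v g
    have := R.toSRN_run y (l.map h ++ (l.map h).take 1)
    rw [List.map_append, List.map_take, List.map_map] at this
    rw [hs, Function.comp_def] at *
    erw [this]
    rw [h2, hΦ G h hh v l hl, hlen]
  have h4 : ((LinearMap.toMatrix' A).submatrix (Fintype.equivFin ε).symm
      (Fintype.equivFin κ).symm) *ᵥ (h v ∘ (Fintype.equivFin κ).symm) =
      A (h v) ∘ (Fintype.equivFin ε).symm := by
    simp [Matrix.submatrix_mulVec_equiv, Function.comp_assoc, LinearMap.toMatrix'_mulVec]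
  rw [Finset.sum_congr rfl h3, Finset.sum_const, ← Nat.cast_smul_eq_nsmul ℝ, smul_smul,
    mul_inv_cancel₀ (by exact_mod_cast (card_pgGroup_pos _).ne'), one_smul, h4, h2]

end Recurrence

/-! ### Counting steps and gating the output -/

namespace Recurrence

variable {κ ε ι : Type}

/-- The recurrence `R` extended by two kinds of coordinates. A one-hot counter `inr (inl k)`,
`k ≤ M`, moves up by one at each step; while it is at `0` the state of `R` is forced to be `0`.
The output coordinate `inr (inr (k, i))` is `max (a k * (P y + Q x + β) i) 0` for the
previous state `y` of `R` and the current input `x`, if the counter was at `k`; it is `0`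
otherwise. Both effects are obtained by subtracting a large constant `C`. -/
noncomputable def gated (R : Recurrence κ ε) (P : (ε → ℝ) →ₗ[ℝ] (ι → ℝ))
    (Q : (κ → ℝ) →ₗ[ℝ] (ι → ℝ)) (β : ι → ℝ) (a : ℕ → ℝ) (C : ℝ) (M : ℕ) :
    Recurrence κ (ε ⊕ Fin (M + 1) ⊕ (Fin (M + 1) × ι)) where
  U := LinearMap.pi <| Sum.elim
    (fun i => LinearMap.proj i ∘ₗ R.U ∘ₗ LinearMap.funLeft ℝ ℝ Sum.inl -
      C • LinearMap.proj (Sum.inr (Sum.inl 0))) <| Sum.elim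
    (Fin.cases 0 fun k => LinearMap.proj (Sum.inr (Sum.inl k.castSucc)))
    (fun p => a p.1 • LinearMap.proj p.2 ∘ₗ P ∘ₗ LinearMap.funLeft ℝ ℝ Sum.inl +
      C • LinearMap.proj (Sum.inr (Sum.inl p.1)))
  W := LinearMap.pi <| Sum.elim (fun i => LinearMap.proj i ∘ₗ R.W) <| Sum.elim
    (fun _ => 0) (fun p => a p.1 • LinearMap.proj p.2 ∘ₗ Q)
  b := Sum.elim R.b <| Sum.elim (fun _ => 0) (fun p => a p.1 * β p.2 - C)

/-- The state `z` of a gated recurrence represents the inner state `y` with the counter at `j`. -/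
def Represents {M : ℕ} (z : ε ⊕ Fin (M + 1) ⊕ (Fin (M + 1) × ι) → ℝ) (y : ε → ℝ) (j : ℕ) : Prop :=
  z ∘ Sum.inl = y ∧ ∀ k : Fin (M + 1), z (Sum.inr (Sum.inl k)) = if (k : ℕ) = j then 1 else 0

/-- The sum of the output coordinates over all positions of the counter. -/
noncomputable def readout (M : ℕ) : (ε ⊕ Fin (M + 1) ⊕ (Fin (M + 1) × ι) → ℝ) →ₗ[ℝ] (ι → ℝ) :=
  LinearMap.pi fun i => ∑ k, LinearMap.proj (Sum.inr (Sum.inr (k, i)))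

@[simp]
theorem readout_apply {M : ℕ} (z : ε ⊕ Fin (M + 1) ⊕ (Fin (M + 1) × ι) → ℝ) (i : ι) :
    readout M z i = ∑ k, z (Sum.inr (Sum.inr (k, i))) := by
  simp [readout]

section
variable {R : Recurrence κ ε} {P : (ε → ℝ) →ₗ[ℝ] (ι → ℝ)}
    {Q : (κ → ℝ) →ₗ[ℝ] (ι → ℝ)} {β : ι → ℝ} {a : ℕ → ℝ} {C : ℝ} {M : ℕ}
    {z : ε ⊕ Fin (M + 1) ⊕ (Fin (M + 1) × ι) → ℝ} {y : ε → ℝ} {j : ℕ}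

theorem gated_step_counter (hz : Represents z y j) (x : κ → ℝ) (k : Fin (M + 1)) :
    (R.gated P Q β a C M).step z x (Sum.inr (Sum.inl k)) = if (k : ℕ) = j + 1 then 1 else 0 := by
  refine Fin.cases ?_ (fun k => ?_) k
  · simp [step, pre, gated]
  · simp only [step, pre, gated, Pi.add_apply, LinearMap.pi_apply, Sum.elim_inr, Sum.elim_inl,
      Fin.cases_succ, LinearMap.proj_apply, hz.2, LinearMap.zero_apply, add_zero, Fin.val_succ,
      Fin.val_castSucc, Nat.add_right_cancel_iff]
    split_ifs <;> simp

/-- In the first step from the counter position `0` the input is ignored. -/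
theorem Represents.step_zero (hz : Represents z 0 0) (x : κ → ℝ) (hx : ∀ i, (R.W x + R.b) i ≤ C) :
    Represents ((R.gated P Q β a C M).step z x) 0 1 := by
  refine ⟨funext fun i => ?_, gated_step_counter hz x⟩
  have h0 : LinearMap.funLeft ℝ ℝ Sum.inl z = (0 : ε → ℝ) := hz.1
  have hx := hx i
  simp only [Pi.add_apply] at hx
  simp only [step, pre, gated, Function.comp_apply, Pi.add_apply, LinearMap.pi_apply,
    Sum.elim_inl, LinearMap.sub_apply, LinearMap.comp_apply, LinearMap.smul_apply, h0, map_zero,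
    LinearMap.proj_apply, hz.2, Pi.zero_apply, smul_eq_mul]
  simpa using by linarith

theorem Represents.step (hz : Represents z y (j + 1)) (x : κ → ℝ) :
    Represents ((R.gated P Q β a C M).step z x) (R.step y x) (j + 2) := by
  refine ⟨funext fun i => ?_, gated_step_counter hz x⟩
  have h0 : LinearMap.funLeft ℝ ℝ Sum.inl z = y := hz.1
  simp [Recurrence.step, pre, gated, h0, hz.2]

theorem Represents.run (hz : Represents z y (j + 1)) (l : List (κ → ℝ)) :
    Represents ((R.gated P Q β a C M).run z l) (R.run y l) (j + l.length + 1) := by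
  induction l generalizing z y j with
  | nil => exact hz
  | cons x l ih =>
    have := ih (hz.step (R := R) (P := P) (Q := Q) (β := β) (a := a) (C := C) x)
    rw [show j + 1 + l.length + 1 = j + (x :: l).length + 1 by simp; omega] at this
    exact this

theorem Represents.readout_step (hz : Represents z y j) (hj : j ≤ M) (x : κ → ℝ)
    (ha : ∀ k, 0 ≤ a k ∧ a k ≤ 1) (hC : ∀ i, |(P y + Q x + β) i| ≤ C) :
    readout M ((R.gated P Q β a C M).step z x) = fun i => a j * max ((P y + Q x + β) i) 0 := by
  funext i
  have h0 : LinearMap.funLeft ℝ ℝ Sum.inl z = y := hz.1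
  have key : ∀ k : Fin (M + 1), (R.gated P Q β a C M).step z x (Sum.inr (Sum.inr (k, i))) =
      if k = ⟨j, by omega⟩ then a j * max ((P y + Q x + β) i) 0 else 0 := by
    intro k
    have e : (R.gated P Q β a C M).step z x (Sum.inr (Sum.inr (k, i))) =
        max (a k * (P y + Q x + β) i + C * (if (k : ℕ) = j then 1 else 0) - C) 0 := by
      simp only [Recurrence.step, pre, gated, Pi.add_apply, LinearMap.pi_apply, Sum.elim_inr,
        LinearMap.add_apply, LinearMap.smul_apply, LinearMap.comp_apply, h0, LinearMap.proj_apply,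
        hz.2, smul_eq_mul]
      congr 1
      ring
    rw [e]
    by_cases hk : (k : ℕ) = j
    · rw [if_pos hk, if_pos (Fin.ext hk), hk, mul_max_of_nonneg _ _ (ha j).1]
      simp
    · rw [if_neg hk, if_neg (fun h => hk (by rw [h]))]
      have h1 : a k * (P y + Q x + β) i ≤ C :=
        calc a k * (P y + Q x + β) i ≤ |a k * (P y + Q x + β) i| := le_abs_self _
          _ = a k * |(P y + Q x + β) i| := by rw [abs_mul, abs_of_nonneg (ha k).1]
          _ ≤ 1 * |(P y + Q x + β) i| := by gcongr; exact (ha k).2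
          _ ≤ C := by rw [one_mul]; exact hC i
      rw [max_eq_right]
      linarith
  simp [key]

end

variable [Fintype κ] [Fintype ε] [Fintype ι]

theorem exists_norm_run_le (R : Recurrence κ ε) (B : ℝ) (n : ℕ) (K : ℝ) :
    ∃ K', ∀ y : ε → ℝ, ‖y‖ ≤ K → ∀ l : List (κ → ℝ), l.length ≤ n → (∀ x ∈ l, ‖x‖ ≤ B) →
      ‖R.run y l‖ ≤ K' := by
  induction n generalizing K with
  | zero =>
    refine ⟨K, fun y hy l hl _ => ?_⟩
    rw [List.length_eq_zero_iff.mp (Nat.le_zero.mp hl)]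
    exact hy
  | succ n ih =>
    let U := LinearMap.toContinuousLinearMap R.U
    let W := LinearMap.toContinuousLinearMap R.W
    obtain ⟨K', hK'⟩ := ih (‖U‖ * K + ‖W‖ * B + ‖R.b‖)
    refine ⟨max K K', fun y hy l hl hx => ?_⟩
    cases l with
    | nil => exact hy.trans (le_max_left _ _)
    | cons x l =>
      refine (hK' (R.step y x) ?_ l (by simpa using hl) fun w hw => hx w (by simp [hw])).trans
        (le_max_right _ _)
      have hU : ‖U y‖ ≤ ‖U‖ * K := (U.le_opNorm y).trans (by gcongr)
      have hW : ‖W x‖ ≤ ‖W‖ * B := (W.le_opNorm x).trans (by gcongr; exact hx x (by simp))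
      have hpre : ‖R.pre y x‖ ≤ ‖U‖ * K + ‖W‖ * B + ‖R.b‖ :=
        (norm_add₃_le (a := U y) (b := W x) (c := R.b)).trans (by gcongr)
      refine (pi_norm_le_iff_of_nonneg ((norm_nonneg _).trans hpre)).mpr fun i => ?_
      refine le_trans ?_ ((norm_le_pi_norm _ i).trans hpre)
      rw [step, Real.norm_eq_abs, Real.norm_eq_abs, abs_of_nonneg (le_max_right _ _)]
      exact max_le (le_abs_self _) (abs_nonneg _)

variable {V : Type} [Fintype V] {D : SimpleGraph V → (V → κ → ℝ) → Prop}

theorem _root_.IsNbrList.length_le {G : SimpleGraph V} {v : V} {l : List V} (hl : IsNbrList G v l) :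
    l.length ≤ Fintype.card V :=
  hl.1.length_le_card

/-- The value of a linear readout `P` of the recurrence `R`, started at `0`, on the sequences of
neighbours, when it does not depend on the order of the neighbours. -/
def ReadsNbrs (R : Recurrence κ ε) (P : (ε → ℝ) →ₗ[ℝ] (ι → ℝ))
    (D : SimpleGraph V → (V → κ → ℝ) → Prop)
    (T : SimpleGraph V → (V → κ → ℝ) → V → ι → ℝ) : Prop :=
  ∀ G h, D G h → ∀ v l, IsNbrList G v l → P (R.run 0 (l.map h)) = T G h v

/-- On bounded inputs some constant `C` is large enough for the gating. -/
theorem exists_bound (R : Recurrence κ ε) (P : (ε → ℝ) →ₗ[ℝ] (ι → ℝ)) (Q : (κ → ℝ) →ₗ[ℝ] (ι → ℝ))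
    (β : ι → ℝ) (B : ℝ) (hD : ∀ G h, D G h → ∀ v, ‖h v‖ ≤ B) :
    ∃ C, ∀ G h, D G h → ∀ v l, IsNbrList G v l → ∀ w, (∀ i, (R.W (h w) + R.b) i ≤ C) ∧
      ∀ i, |(P (R.run 0 (l.map h)) + Q (h w) + β) i| ≤ C := by
  obtain ⟨K, hK⟩ := R.exists_norm_run_le B (Fintype.card V) 0
  let W := LinearMap.toContinuousLinearMap R.W
  let P' := LinearMap.toContinuousLinearMap P
  let Q' := LinearMap.toContinuousLinearMap Q
  refine ⟨max (‖W‖ * B + ‖R.b‖) (‖P'‖ * K + ‖Q'‖ * B + ‖β‖),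
    fun G h hh v l hl w => ⟨fun i => ?_, fun i => ?_⟩⟩
  · refine le_trans ?_ (le_max_left _ _)
    refine (le_abs_self _).trans ((norm_le_pi_norm (W (h w) + R.b) i).trans ?_)
    refine (norm_add_le _ _).trans ?_
    gcongr
    exact (W.le_opNorm _).trans (by gcongr; exact hD G h hh w)
  · refine le_trans ?_ (le_max_right _ _)
    refine (norm_le_pi_norm (P' (R.run 0 (l.map h)) + Q' (h w) + β) i).trans ?_
    refine norm_add₃_le.trans ?_
    gcongr
    · refine (P'.le_opNorm _).trans ?_
      gcongr
      refine hK 0 (by simp) _ (by simpa using hl.length_le) fun x hx => ?_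
      obtain ⟨u, _, rfl⟩ := List.mem_map.mp hx
      exact hD G h hh u
    · exact (Q'.le_opNorm _).trans (by gcongr; exact hD G h hh w)

/-- The reciprocal of the order of the permutation group on `k - 1` neighbours: when the counter
of a merged layer is at `k`, the recurrence has read the central node and `k - 1` neighbours. -/
noncomputable def invCard (k : ℕ) : ℝ := ((pgGroup (k - 1)).card : ℝ)⁻¹

theorem invCard_succ (k : ℕ) : invCard (k + 1) = ((pgGroup k).card : ℝ)⁻¹ := rfl

theorem invCard_bounds (k : ℕ) : 0 ≤ invCard k ∧ invCard k ≤ 1 :=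
  ⟨by unfold invCard; positivity,
    inv_le_one_of_one_le₀ (by exact_mod_cast card_pgGroup_pos (k - 1))⟩

/-- The merged form rectifies a readout of the neighbours plus an affine function of the central
node, which is the input of the last step. -/
theorem ReadsNbrs.realizes_merged {R : Recurrence κ ε} {P : (ε → ℝ) →ₗ[ℝ] (ι → ℝ)}
    {T : SimpleGraph V → (V → κ → ℝ) → V → ι → ℝ} (hT : R.ReadsNbrs P D T)
    (hD : ∃ B, ∀ G h, D G h → ∀ v, ‖h v‖ ≤ B) (Q : (κ → ℝ) →ₗ[ℝ] (ι → ℝ)) (β : ι → ℝ) :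
    Realizes .merged D fun G h v i => max ((T G h v + Q (h v) + β) i) 0 := by
  obtain ⟨B, hB⟩ := hD
  obtain ⟨C, hC⟩ := R.exists_bound P Q β B hB
  let M := Fintype.card V + 1
  refine Recurrence.realizes_merged (R.gated P Q β invCard C M)
    (Sum.elim 0 (Sum.elim (Pi.single 0 1) 0)) (readout M) fun G h hh v l hl => ?_
  have hz : Represents (ε := ε) (ι := ι)
      (Sum.elim 0 (Sum.elim (Pi.single (0 : Fin (M + 1)) (1 : ℝ)) 0)) 0 0 :=
    ⟨rfl, fun k => by
      simp only [Sum.elim_inr, Sum.elim_inl, Pi.single_apply, Fin.ext_iff, Fin.val_zero]⟩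
  have h1 := hz.step_zero (R := R) (P := P) (Q := Q) (β := β) (a := invCard) (h v)
    (hC G h hh v l hl v).1
  have h2 := h1.run (j := 0) (R := R) (P := P) (Q := Q) (β := β) (a := invCard) (C := C) (l.map h)
  have h3 := h2.readout_step (R := R) (P := P) (Q := Q) (β := β) (a := invCard) (C := C)
    (by have := hl.length_le; rw [List.length_map]; omega) (h v) invCard_bounds
    (hC G h hh v l hl v).2
  rw [hT G h hh v l hl, List.length_map, zero_add, invCard_succ] at h3
  simp only [run, List.foldl_cons, List.foldl_append, List.foldl_nil] at h3 ⊢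
  rw [h3]
  rfl

/-- The separate form rectifies only a readout of the neighbours; the central node enters linearly.
The last step, which reads the first neighbour again, only serves to output the result. -/
theorem ReadsNbrs.realizes_separate {R : Recurrence κ ε} {P : (ε → ℝ) →ₗ[ℝ] (ι → ℝ)}
    {T : SimpleGraph V → (V → κ → ℝ) → V → ι → ℝ} (hT : R.ReadsNbrs P D T)
    (hD : ∃ B, ∀ G h, D G h → ∀ v, ‖h v‖ ≤ B) (β : ι → ℝ) (A : (κ → ℝ) →ₗ[ℝ] (ι → ℝ)) :
    Realizes .separate D fun G h v => (fun i => max ((T G h v + β) i) 0) + A (h v) := by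
  obtain ⟨B, hB⟩ := hD
  obtain ⟨C, hC⟩ := R.exists_bound P 0 β B hB
  let M := Fintype.card V + 1
  -- The counter starts at `1`. The output coordinates of the initial state give the result when
  -- there are no neighbours.
  let z : ε ⊕ Fin (M + 1) ⊕ (Fin (M + 1) × ι) → ℝ := Sum.elim 0 (Sum.elim (Pi.single 1 1)
    fun p => if p.1 = 0 then invCard 1 * max (β p.2) 0 else 0)
  let A' : (κ → ℝ) →ₗ[ℝ] (ε ⊕ Fin (M + 1) ⊕ (Fin (M + 1) × ι) → ℝ) :=
    LinearMap.pi <| Sum.elim 0 <| Sum.elim 0 fun p => if p.1 = 0 then LinearMap.proj p.2 ∘ₗ A else 0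
  have hA' : ∀ x, readout M (A' x) = A x := by
    intro x
    funext i
    have : ∀ k : Fin (M + 1), (if k = 0 then LinearMap.proj i ∘ₗ A else 0) x =
        if k = 0 then A x i else 0 := fun k => by split_ifs <;> simp
    simp [A', this]
  have key := Recurrence.realizes_separate (D := D) (R.gated P 0 β invCard C M) z (readout M) A'
    (Φ := fun G h v i => max ((T G h v + β) i) 0) fun G h hh v l hl => ?_
  · simpa only [hA'] using key
  have hz : Represents z 0 1 :=
    ⟨rfl, fun k => by
      simp only [z, M, Sum.elim_inr, Sum.elim_inl, Pi.single_apply, Fin.ext_iff, Fin.val_one]⟩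
  have h2 := hz.run (j := 0) (R := R) (P := P) (Q := 0) (β := β) (a := invCard) (C := C) (l.map h)
  cases l with
  | nil =>
    have h0 := hT G h hh v [] hl
    simp only [List.map_nil, run, List.foldl_nil, map_zero] at h0
    funext i
    simp [run, z, ← h0, invCard]
  | cons u l =>
    have h3 := h2.readout_step (R := R) (P := P) (Q := 0) (β := β) (a := invCard) (C := C)
      (by have := hl.length_le; rw [List.length_map]; omega) (h u) invCard_bounds
      (hC G h hh v (u :: l) hl u).2
    rw [hT G h hh v (u :: l) hl, List.length_map, zero_add, invCard_succ] at h3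
    simp only [run, List.foldl_cons, List.foldl_append, List.foldl_nil, List.map_cons,
      List.take_succ_cons, List.take_zero] at h3 ⊢
    rw [h3]
    funext i
    simp

/-- Both forms realize an order-independent readout of the neighbours plus an affine function of
the central node. A signed value is the difference of two rectified ones. -/
theorem ReadsNbrs.realizes {F : PGForm} {R : Recurrence κ ε} {P : (ε → ℝ) →ₗ[ℝ] (ι → ℝ)}
    {T : SimpleGraph V → (V → κ → ℝ) → V → ι → ℝ} (hT : R.ReadsNbrs P D T)
    (hD : ∃ B, ∀ G h, D G h → ∀ v, ‖h v‖ ≤ B) (β : ι → ℝ) (A : (κ → ℝ) →ₗ[ℝ] (ι → ℝ)) :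
    Realizes F D fun G h v => T G h v + A (h v) + β := by
  let δ : (ι ⊕ ι → ℝ) →ₗ[ℝ] (ι → ℝ) :=
    LinearMap.funLeft ℝ ℝ Sum.inl - LinearMap.funLeft ℝ ℝ Sum.inr
  have hT' : R.ReadsNbrs
      (LinearMap.pi <| Sum.elim (fun i => LinearMap.proj i ∘ₗ P) fun i => -(LinearMap.proj i ∘ₗ P))
      D fun G h v => Sum.elim (T G h v) (-(T G h v)) := by
    intro G h hh v l hl
    funext i
    cases i <;> simp [hT G h hh v l hl]
  have hmax : ∀ t : ℝ, max t 0 - max (-t) 0 = t := fun t => by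
    rcases le_total t 0 with h | h <;> simp [h]
  cases F with
  | merged =>
    refine ((hT'.realizes_merged hD (LinearMap.pi <| Sum.elim (fun i => LinearMap.proj i ∘ₗ A)
      fun i => -(LinearMap.proj i ∘ₗ A)) (Sum.elim β (-β))).linear_comp δ).congr fun G h _ => ?_
    funext v i
    simp only [δ, LinearMap.sub_apply, Pi.sub_apply, LinearMap.funLeft_apply, Pi.add_apply,
      Sum.elim_inl, Sum.elim_inr, LinearMap.pi_apply, LinearMap.neg_apply, LinearMap.comp_apply,
      LinearMap.proj_apply, Pi.neg_apply]
    rw [← neg_add, ← neg_add, hmax]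
  | separate =>
    refine ((hT'.realizes_separate hD (Sum.elim β (-β)) (LinearMap.pi <| Sum.elim
      (fun i => LinearMap.proj i ∘ₗ A) 0)).linear_comp δ).congr fun G h _ => ?_
    funext v i
    simp only [δ, LinearMap.sub_apply, Pi.sub_apply, LinearMap.funLeft_apply, Pi.add_apply,
      Sum.elim_inl, Sum.elim_inr, LinearMap.pi_apply, LinearMap.zero_apply, LinearMap.comp_apply,
      LinearMap.proj_apply, Pi.neg_apply, Pi.zero_apply, add_zero]
    rw [← neg_add, add_sub_right_comm, hmax]
    ring

end Recurrence

/-! ### Sums over the neighbours read so far -/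

namespace Recurrence

variable {κ σ μ ι : Type}

/-- The recurrence with state `(S, q, r)` that adds up the vectors `E x` in `S`, computes in `q` the
rectification of `M S + W x + b`, with `S` taken before the input `x`, and adds up the vectors `q`
in `r` with a delay of one step. -/
def prefixRec (E : (κ → ℝ) →ₗ[ℝ] (σ → ℝ)) (M : (σ → ℝ) →ₗ[ℝ] (μ → ℝ))
    (W : (κ → ℝ) →ₗ[ℝ] (μ → ℝ)) (b : μ → ℝ) : Recurrence κ (σ ⊕ μ ⊕ μ) where
  U := LinearMap.pi <| Sum.elim
    (fun i => LinearMap.proj (Sum.inl i)) <| Sum.elim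
    (fun i => LinearMap.proj i ∘ₗ M ∘ₗ LinearMap.funLeft ℝ ℝ Sum.inl)
    (fun i => LinearMap.proj (R := ℝ) (φ := fun _ : σ ⊕ μ ⊕ μ => ℝ) (Sum.inr (Sum.inr i)) +
      LinearMap.proj (Sum.inr (Sum.inl i)))
  W := LinearMap.pi <| Sum.elim (fun i => LinearMap.proj i ∘ₗ E) <| Sum.elim
    (fun i => LinearMap.proj i ∘ₗ W) 0
  b := Sum.elim 0 (Sum.elim b 0)

/-- The sum over the entries `x` of the list of `relu (M S + W x + b)`, where `S` is the initial
value plus the sum of `E x'` over the preceding entries `x'`. -/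
noncomputable def prefixSum (E : (κ → ℝ) →ₗ[ℝ] (σ → ℝ)) (M : (σ → ℝ) →ₗ[ℝ] (μ → ℝ))
    (W : (κ → ℝ) →ₗ[ℝ] (μ → ℝ)) (b : μ → ℝ) : (σ → ℝ) → List (κ → ℝ) → μ → ℝ
  | _, [] => 0
  | S, x :: l => (fun i => max ((M S + W x + b) i) 0) + prefixSum E M W b (S + E x) l

/-- The sum of all vectors `q` computed so far, the last one included. -/
def prefixReadout : (σ ⊕ μ ⊕ μ → ℝ) →ₗ[ℝ] (μ → ℝ) :=
  LinearMap.funLeft ℝ ℝ (fun i => Sum.inr (Sum.inl i)) +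
    LinearMap.funLeft ℝ ℝ (fun i => Sum.inr (Sum.inr i))

theorem prefixReadout_run (E : (κ → ℝ) →ₗ[ℝ] (σ → ℝ)) (M : (σ → ℝ) →ₗ[ℝ] (μ → ℝ))
    (W : (κ → ℝ) →ₗ[ℝ] (μ → ℝ)) (b : μ → ℝ) (l : List (κ → ℝ)) (hl : ∀ x ∈ l, 0 ≤ E x)
    (S : σ → ℝ) (hS : 0 ≤ S) (q r : μ → ℝ) (hq : 0 ≤ q) (hr : 0 ≤ r) :
    prefixReadout ((prefixRec E M W b).run (Sum.elim S (Sum.elim q r)) l) =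
      q + r + prefixSum E M W b S l := by
  induction l generalizing S q r with
  | nil =>
    funext i
    simp [run, prefixReadout, prefixSum, LinearMap.funLeft]
  | cons x l ih =>
    have hx := hl x (by simp)
    have hstep : (prefixRec E M W b).step (Sum.elim S (Sum.elim q r)) x =
        Sum.elim (S + E x) (Sum.elim (fun i => max ((M S + W x + b) i) 0) (r + q)) := by
      have hSf : LinearMap.funLeft ℝ ℝ Sum.inl (Sum.elim S (Sum.elim q r)) = S := rfl
      funext i
      rcases i with i | i | i
      · have := add_nonneg (hS i) (hx i)
        simpa [step, pre, prefixRec] using this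
      · simp [step, pre, prefixRec, hSf]
      · have := add_nonneg (hr i) (hq i)
        simpa [step, pre, prefixRec] using this
    rw [run, List.foldl_cons, hstep]
    refine (ih (fun w hw => hl w (by simp [hw])) _ (add_nonneg hS hx)
      (fun i => max ((M S + W x + b) i) 0) _ (fun i => le_max_right _ _) (add_nonneg hr hq)).trans
      ?_
    rw [prefixSum]
    funext i
    simp only [Pi.add_apply]
    ring

open Classical in
theorem _root_.IsNbrList.sum_map {V A : Type*} [Fintype V] [AddCommMonoid A] {G : SimpleGraph V}
    {v : V} {l : List V} (hl : IsNbrList G v l) (f : V → A) :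
    (l.map f).sum = ∑ u with G.Adj v u, f u := by
  rw [← List.sum_toFinset f hl.1]
  congr 1
  ext u
  simp [hl.2]

variable {F : PGForm} {V : Type} [Fintype V] [Fintype κ] [Fintype ι] [Fintype σ] [Fintype μ]
  {D : SimpleGraph V → (V → κ → ℝ) → Prop}

/-- Both forms realize linear functions of an order-independent prefix sum over the neighbours, plus
an affine function of the central node. -/
theorem realizes_prefixSum (hD : ∃ B, ∀ G h, D G h → ∀ v, ‖h v‖ ≤ B)
    (E : (κ → ℝ) →ₗ[ℝ] (σ → ℝ)) (M : (σ → ℝ) →ₗ[ℝ] (μ → ℝ))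
    (W : (κ → ℝ) →ₗ[ℝ] (μ → ℝ)) (b : μ → ℝ) (P : (μ → ℝ) →ₗ[ℝ] (ι → ℝ))
    (hE : ∀ G h, D G h → ∀ v, 0 ≤ E (h v)) {T : SimpleGraph V → (V → κ → ℝ) → V → ι → ℝ}
    (hT : ∀ G h, D G h → ∀ v l, IsNbrList G v l → P (prefixSum E M W b 0 (l.map h)) = T G h v)
    (A : (κ → ℝ) →ₗ[ℝ] (ι → ℝ)) (β : ι → ℝ) :
    Realizes F D fun G h v => T G h v + A (h v) + β := by
  have hR : (prefixRec E M W b).ReadsNbrs (P ∘ₗ prefixReadout) D T := by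
    intro G h hh v l hl
    have h0 : (0 : σ ⊕ μ ⊕ μ → ℝ) = Sum.elim (0 : σ → ℝ) (Sum.elim (0 : μ → ℝ) (0 : μ → ℝ)) := by
      funext i
      rcases i with i | i | i <;> rfl
    rw [LinearMap.comp_apply, h0, prefixReadout_run E M W b _ _ 0 le_rfl 0 0 le_rfl le_rfl,
      ← hT G h hh v l hl]
    · simp
    · intro x hx
      obtain ⟨u, _, rfl⟩ := List.mem_map.mp hx
      exact hE G h hh u
  exact hR.realizes hD β A

open Classical in
/-- Both forms realize one message-passing round with rectified messages. -/
theorem realizes_messages (hD : ∃ B, ∀ G h, D G h → ∀ v, ‖h v‖ ≤ B)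
    (W : (κ → ℝ) →ₗ[ℝ] (μ → ℝ)) (b : μ → ℝ) (P : (μ → ℝ) →ₗ[ℝ] (ι → ℝ))
    (A : (κ → ℝ) →ₗ[ℝ] (ι → ℝ)) (β : ι → ℝ) :
    Realizes F D fun G h v =>
      (∑ u with G.Adj v u, P fun i => max ((W (h u) + b) i) 0) + A (h v) + β := by
  refine realizes_prefixSum (σ := Empty) hD 0 0 W b P (fun _ _ _ _ => le_rfl)
    (T := fun G h v => ∑ u with G.Adj v u, P fun i => max ((W (h u) + b) i) 0)
    (fun G h _ v l hl => ?_) A β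
  rw [← hl.sum_map]
  have : ∀ S, P (prefixSum (σ := Empty) 0 0 W b S (l.map h)) =
      (l.map fun u => P fun i => max ((W (h u) + b) i) 0).sum := by
    clear hl
    induction l with
    | nil => simp [prefixSum]
    | cons u l ih =>
      intro S
      simp [prefixSum, ih]
  exact this 0

open Classical in
/-- Both forms realize one round of message passing with linear messages: a signed value is the
difference of two rectified ones. -/
theorem realizes_linearMessages (hD : ∃ B, ∀ G h, D G h → ∀ v, ‖h v‖ ≤ B)
    (W A : (κ → ℝ) →ₗ[ℝ] (ι → ℝ)) (β : ι → ℝ) :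
    Realizes F D fun G h v => (∑ u with G.Adj v u, W (h u)) + A (h v) + β := by
  refine (realizes_messages (μ := ι ⊕ ι) hD (LinearMap.pi <| Sum.elim
    (fun i => LinearMap.proj i ∘ₗ W) fun i => -(LinearMap.proj i ∘ₗ W)) 0
    (LinearMap.funLeft ℝ ℝ Sum.inl - LinearMap.funLeft ℝ ℝ Sum.inr) A β).congr fun G h _ => ?_
  funext v
  congr 2
  refine Finset.sum_congr rfl fun u _ => ?_
  funext i
  simp [LinearMap.funLeft]

/-- The merged form realizes rectified affine functions of the central node. -/
theorem realizes_relu (hD : ∃ B, ∀ G h, D G h → ∀ v, ‖h v‖ ≤ B)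
    (A : (κ → ℝ) →ₗ[ℝ] (ι → ℝ)) (β : ι → ℝ) :
    Realizes .merged D fun _ h v i => max ((A (h v) + β) i) 0 := by
  let R : Recurrence κ Empty := ⟨0, 0, 0⟩
  have hR : R.ReadsNbrs (0 : (Empty → ℝ) →ₗ[ℝ] (ι → ℝ)) D 0 := fun _ _ _ _ _ _ => rfl
  refine (hR.realizes_merged hD A β).congr fun G h _ => ?_
  simp

end Recurrence

/-! ### Simulation of GINs -/

/-- Networks of the form `F` realize the functional `Φ` on every bounded set of features, and `Φ`
maps bounded sets of features to bounded sets. The second property allows composition. -/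
def Simulable (F : PGForm) {V κ ι : Type} [Fintype κ] [Fintype ι]
    (Φ : SimpleGraph V → (V → κ → ℝ) → V → ι → ℝ) : Prop :=
  ∀ B : ℝ, Realizes F (fun _ h => ∀ v, ‖h v‖ ≤ B) Φ ∧
    ∃ B', ∀ G h, (∀ v, ‖h v‖ ≤ B) → ∀ v, ‖Φ G h v‖ ≤ B'

namespace Simulable

variable {F : PGForm} {V κ ι ρ : Type} [Fintype κ] [Fintype ι] [Fintype ρ]

theorem id : Simulable F fun (_ : SimpleGraph V) (h : V → κ → ℝ) => h := fun B =>
  ⟨Realizes.linear LinearMap.id, B, fun _ _ h => h⟩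

theorem comp {Ψ : SimpleGraph V → (V → ι → ℝ) → V → ρ → ℝ}
    {Φ : SimpleGraph V → (V → κ → ℝ) → V → ι → ℝ} (hΨ : Simulable F Ψ) (hΦ : Simulable F Φ) :
    Simulable F fun G h => Ψ G (Φ G h) := fun B => by
  obtain ⟨h1, B', hB'⟩ := hΦ B
  obtain ⟨h2, B'', hB''⟩ := hΨ B'
  exact ⟨h2.comp h1 hB', B'', fun G h hh => hB'' G _ (hB' G h hh)⟩

theorem norm_affine_le (W : Matrix ι κ ℝ) (b : ι → ℝ) {B : ℝ} {x : κ → ℝ} (hx : ‖x‖ ≤ B) :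
    ‖W *ᵥ x + b‖ ≤ ‖LinearMap.toContinuousLinearMap W.mulVecLin‖ * B + ‖b‖ := by
  refine (norm_add_le _ _).trans ?_
  gcongr
  exact ((LinearMap.toContinuousLinearMap W.mulVecLin).le_opNorm x).trans (by gcongr)

variable [Fintype V]

theorem affine (W : Matrix ι κ ℝ) (b : ι → ℝ) :
    Simulable F fun (_ : SimpleGraph V) (h : V → κ → ℝ) v => W *ᵥ h v + b := fun B => by
  refine ⟨?_, _, fun G h hh v => norm_affine_le W b (hh v)⟩
  refine (Recurrence.realizes_linearMessages ⟨B, fun _ _ h => h⟩ 0 W.mulVecLin b).congr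
    fun G h _ => ?_
  simp

theorem relu (W : Matrix ι κ ℝ) (b : ι → ℝ) : Simulable .merged
    fun (_ : SimpleGraph V) (h : V → κ → ℝ) v i => max ((W *ᵥ h v + b) i) 0 := fun B => by
  refine ⟨Recurrence.realizes_relu ⟨B, fun _ _ h => h⟩ W.mulVecLin b,
    ‖LinearMap.toContinuousLinearMap W.mulVecLin‖ * B + ‖b‖, fun G h hh v => ?_⟩
  have h0 := norm_affine_le W b (hh v)
  refine (pi_norm_le_iff_of_nonneg ((norm_nonneg _).trans h0)).mpr fun i => ?_
  refine le_trans ?_ ((norm_le_pi_norm _ i).trans h0)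
  rw [Real.norm_eq_abs, Real.norm_eq_abs, abs_of_nonneg (le_max_right _ _)]
  exact max_le (le_abs_self _) (abs_nonneg _)

open Classical in
theorem aggregate : Simulable F fun (G : SimpleGraph V) (h : V → κ → ℝ) v =>
    h v + ∑ u ∈ G.neighborFinset v, h u := fun B => by
  constructor
  · refine (Recurrence.realizes_linearMessages ⟨B, fun _ _ h => h⟩ LinearMap.id LinearMap.id
      0).congr fun G h _ => ?_
    funext v
    simp only [LinearMap.id_apply, add_zero]
    rw [add_comm]
    congr 2
    ext u
    simp
  · refine ⟨B + Fintype.card V * B, fun G h hh v => (norm_add_le _ _).trans ?_⟩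
    refine add_le_add (hh v) ((norm_sum_le_of_le _ fun u _ => hh u).trans ?_)
    rw [Finset.sum_const, nsmul_eq_mul]
    have : 0 ≤ B := (norm_nonneg _).trans (hh v)
    gcongr
    exact Finset.card_le_univ _

theorem mlp_merged {d e : ℕ} (M : MLP d e) :
    Simulable .merged fun (_ : SimpleGraph V) (h : V → Fin d → ℝ) v => M.eval (h v) := by
  induction M with
  | affine W b => exact affine W b
  | hidden W b rest ih => exact ih.comp (relu W b)

theorem gin_merged {d e : ℕ} (gin : GIN e d) :
    Simulable .merged fun (G : SimpleGraph V) h => gin.features G h := by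
  induction gin with
  | nil => exact id
  | cons M rest ih => exact ih.comp ((mlp_merged M).comp aggregate)

theorem gin_separate {d e : ℕ} (gin : GIN e d) (hgin : gin.IsAffine) :
    Simulable .separate fun (G : SimpleGraph V) h => gin.features G h := by
  induction gin with
  | nil => exact id
  | cons M rest ih =>
    cases M with
    | affine W b => exact (ih hgin.2).comp ((affine W b).comp aggregate)
    | hidden W b M => exact hgin.1.elim

theorem pgSimulates {d e : ℕ} {gin : GIN e d}
    (h : ∀ N, Simulable F fun (G : SimpleGraph (Fin N)) h => gin.features G h) :
    PGSimulates F gin := by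
  intro N B
  obtain ⟨net, hnet⟩ := (h N (max B 0)).1.exists_net
  refine ⟨net, fun G ν x hx => hnet G ν x fun v => ?_⟩
  exact (pi_norm_le_iff_of_nonneg (le_max_right _ _)).mpr fun i => (hx v i).trans (le_max_left _ _)

end Simulable

/-! ### Counting cliques inside a set of vertices -/

open Classical in
/-- The number of `m`-cliques all of whose vertices lie in `A`. -/
noncomputable def cliquesIn {V : Type*} (G : SimpleGraph V) (m : ℕ) (A : Finset V) : ℕ :=
  (A.powerset.filter fun s => G.IsNClique m s).card

theorem isNClique_succ_insert_iff {V : Type*} [DecidableEq V] {G : SimpleGraph V} {m : ℕ}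
    {s : Finset V} {x : V} (hx : x ∉ s) :
    G.IsNClique (m + 1) (insert x s) ↔ G.IsNClique m s ∧ ∀ u ∈ s, G.Adj x u := by
  refine ⟨fun h => ?_, fun h => h.1.insert h.2⟩
  have h1 := h.isClique
  rw [Finset.coe_insert, SimpleGraph.isClique_insert_of_notMem (by simpa using hx)] at h1
  have h2 := h.card_eq
  rw [Finset.card_insert_of_notMem hx] at h2
  exact ⟨⟨h1.1, by omega⟩, h1.2⟩

open Classical in
/-- The new cliques consist of `x` and a clique of neighbours of `x` in `A`. -/
theorem cliquesIn_succ_insert {V : Type*} (G : SimpleGraph V) (m : ℕ) {A : Finset V} {x : V}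
    (hx : x ∉ A) : cliquesIn G (m + 1) (insert x A) =
      cliquesIn G (m + 1) A + cliquesIn G m (A.filter fun u => G.Adj x u) := by
  unfold cliquesIn
  rw [Finset.powerset_insert, Finset.filter_union, Finset.card_union_of_disjoint]
  · congr 1
    rw [Finset.filter_image, Finset.card_image_of_injOn]
    · congr 1
      ext s
      simp only [Finset.mem_filter, Finset.mem_powerset]
      constructor
      · rintro ⟨hs, hc⟩
        rw [isNClique_succ_insert_iff (fun h => hx (hs h))] at hc
        exact ⟨fun u hu => Finset.mem_filter.mpr ⟨hs hu, hc.2 u hu⟩, hc.1⟩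
      · rintro ⟨hs, hc⟩
        exact ⟨fun u hu => (Finset.mem_filter.mp (hs hu)).1,
          hc.insert fun u hu => (Finset.mem_filter.mp (hs hu)).2⟩
    · intro s hs t ht hst
      have hs' : x ∉ s := fun h => hx (Finset.mem_powerset.mp (Finset.mem_filter.mp hs).1 h)
      have ht' : x ∉ t := fun h => hx (Finset.mem_powerset.mp (Finset.mem_filter.mp ht).1 h)
      rw [← Finset.erase_insert hs', ← Finset.erase_insert ht']
      exact congrArg (fun r => r.erase x) hst
  · refine Finset.disjoint_left.mpr fun s hs ht => ?_
    obtain ⟨ht, _⟩ := Finset.mem_filter.mp ht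
    obtain ⟨t, _, rfl⟩ := Finset.mem_image.mp ht
    exact hx (Finset.mem_powerset.mp (Finset.mem_filter.mp hs).1 (Finset.mem_insert_self x t))

theorem cliquesIn_zero {V : Type*} (G : SimpleGraph V) (A : Finset V) : cliquesIn G 0 A = 1 := by
  classical
  rw [cliquesIn, Finset.card_eq_one]
  refine ⟨∅, ?_⟩
  ext s
  simp only [Finset.mem_filter, Finset.mem_powerset, SimpleGraph.isNClique_zero,
    Finset.mem_singleton]
  exact ⟨fun h => h.2, fun h => ⟨by simp [h], h⟩⟩

theorem cliquesIn_succ_empty {V : Type*} (G : SimpleGraph V) (m : ℕ) :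
    cliquesIn G (m + 1) ∅ = 0 := by
  classical
  rw [cliquesIn, Finset.card_eq_zero]
  ext s
  simp only [Finset.mem_filter, Finset.mem_powerset, Finset.subset_empty, Finset.notMem_empty,
    iff_false]
  rintro ⟨rfl, h⟩
  simpa using h.card_eq

theorem cliquesIn_one {V : Type*} (G : SimpleGraph V) (A : Finset V) :
    cliquesIn G 1 A = A.card := by
  classical
  induction A using Finset.induction_on with
  | empty => exact cliquesIn_succ_empty G 0
  | insert x A hx ih => rw [cliquesIn_succ_insert G 0 hx, ih, cliquesIn_zero,
      Finset.card_insert_of_notMem hx]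

open Classical in
theorem incidenceCliques_succ {V : Type*} [Fintype V] (G : SimpleGraph V) (m : ℕ) (v : V) :
    incidenceCliques G (m + 1) v = cliquesIn G m {u | G.Adj v u} := by
  have hv : ∀ s : Finset V, s ⊆ ({u | G.Adj v u} : Finset V) → v ∉ s := fun s hs h => by
    simpa using hs h
  have hinj : Set.InjOn (fun s : Finset V => insert v s)
      (({u | G.Adj v u} : Finset V).powerset.filter fun s => G.IsNClique m s) := by
    intro s hs t ht hst
    have hs' := hv s (Finset.mem_powerset.mp (Finset.mem_filter.mp hs).1)
    have ht' := hv t (Finset.mem_powerset.mp (Finset.mem_filter.mp ht).1)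
    rw [← Finset.erase_insert hs', ← Finset.erase_insert ht']
    exact congrArg (fun r => r.erase v) hst
  rw [incidenceCliques, cliquesIn, ← Set.ncard_coe_finset, ← hinj.ncard_image]
  congr 1
  ext s
  simp only [Set.mem_image, Finset.mem_coe, Finset.mem_filter, Finset.mem_powerset]
  constructor
  · rintro ⟨hvs, hs⟩
    rw [← Finset.insert_erase hvs, isNClique_succ_insert_iff (Finset.notMem_erase v s)] at hs
    exact ⟨s.erase v, ⟨fun u hu => by simpa using hs.2 u hu, hs.1⟩, Finset.insert_erase hvs⟩
  · rintro ⟨t, ⟨ht, hc⟩, rfl⟩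
    exact ⟨Finset.mem_insert_self v t, hc.insert fun u hu => by simpa using ht hu⟩

/-- The truth value of a proposition as a real number. -/
noncomputable def ind (p : Prop) [Decidable p] : ℝ := if p then 1 else 0

open Classical in
theorem sum_adj_eq_two_mul {V : Type*} (G : SimpleGraph V) (A : Finset V) :
    ∑ a ∈ A, ∑ b ∈ A, ind (G.Adj a b) = 2 * cliquesIn G 2 A := by
  induction A using Finset.induction_on with
  | empty => simp [cliquesIn_succ_empty]
  | insert x A hx ih =>
    have h1 : ∀ a, ind (G.Adj a x) = ind (G.Adj x a) := fun a => by
      simp only [ind, G.adj_comm]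
    have h2 : ∑ a ∈ A, ind (G.Adj x a) = (A.filter fun u => G.Adj x u).card := by
      simp [ind]
    rw [cliquesIn_succ_insert G 1 hx, cliquesIn_one, Finset.sum_insert hx, Finset.sum_insert hx]
    simp only [Finset.sum_insert hx, Finset.sum_add_distrib, ih, h1, h2]
    simp only [ind, SimpleGraph.irrefl, if_false]
    push_cast
    ring

theorem sum_filter_filter {V : Type*} [Fintype V] (p : V → Prop) [DecidablePred p]
    (f : V → V → ℝ) :
    ∑ a with p a, ∑ b with p b, f a b = ∑ a, ∑ b, if p a ∧ p b then f a b else 0 := by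
  rw [Finset.sum_filter]
  refine Finset.sum_congr rfl fun a _ => ?_
  split_ifs with h <;> simp [h, Finset.sum_filter]

/-! ### Networks counting triangles and 4-cliques -/

namespace CliqueNet

variable {F : PGForm} {V J : Type}

/-- The features are the identifiers of the nodes, as unit vectors. -/
def IsIdent (_ : SimpleGraph V) (h : V → J → ℝ) : Prop :=
  open Classical in ∃ id : V ≃ J, ∀ v w, h v (id w) = ind (v = w)

/-- The features are the identifiers together with the rows of the adjacency matrix. -/
def IsAdj (G : SimpleGraph V) (h : V → J ⊕ J → ℝ) : Prop :=
  open Classical in ∃ id : V ≃ J, (∀ v w, h v (.inl (id w)) = ind (v = w)) ∧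
    ∀ v w, h v (.inr (id w)) = ind (G.Adj v w)

/-- The features are the identifiers together with the adjacency matrices of the subgraphs induced
on the neighbourhoods. -/
def IsNbrAdj (G : SimpleGraph V) (h : V → J ⊕ J × J → ℝ) : Prop :=
  open Classical in ∃ id : V ≃ J, (∀ v w, h v (.inl (id w)) = ind (v = w)) ∧
    ∀ v a b, h v (.inr (id a, id b)) = ind (G.Adj v a ∧ G.Adj v b ∧ G.Adj a b)

theorem norm_le_one_of_forall {ι : Type} [Fintype ι] {x : ι → ℝ}
    (h : ∀ i, ∃ (p : Prop) (_ : Decidable p), x i = ind p) : ‖x‖ ≤ 1 := by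
  refine (pi_norm_le_iff_of_nonneg zero_le_one).mpr fun i => ?_
  obtain ⟨p, _, hp⟩ := h i
  rw [hp, ind]
  split_ifs <;> simp

/-- The set of vertices `A` as a vector indexed by the identifiers. -/
noncomputable def indVec (id : V ≃ J) (A : Finset V) : J → ℝ :=
  open Classical in fun i => ind (id.symm i ∈ A)

open Classical in
theorem indVec_apply (id : V ≃ J) (A : Finset V) (w : V) : indVec id A (id w) = ind (w ∈ A) := by
  simp [indVec]

open Classical in
theorem indVec_insert (id : V ≃ J) {A : Finset V} {u : V} (hu : u ∉ A) {x : J → ℝ}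
    (hx : ∀ w, x (id w) = ind (u = w)) : indVec id A + x = indVec id (insert u A) := by
  funext i
  obtain ⟨w, rfl⟩ := id.surjective i
  rw [Pi.add_apply, indVec_apply, indVec_apply, hx]
  by_cases huw : u = w
  · subst huw
    simp [ind, hu]
  · simp [ind, huw, Ne.symm huw]

/-- The inputs of the messages in the layer that finds the edges between the neighbours: a
neighbour `u` contributes to the pair `(i, j)` if `i` has been read before, `j` is the identifier
of `u`, and `u` is adjacent to `i`. -/
def edgeInput : (J ⊕ J → ℝ) →ₗ[ℝ] (J × J → ℝ) :=
  LinearMap.funLeft ℝ ℝ (fun p => .inl p.2) + LinearMap.funLeft ℝ ℝ (fun p => .inr p.1)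

open Classical in
/-- Each edge between two neighbours is found once, when the second of its ends is read. -/
theorem prefixSum_edge {G : SimpleGraph V} {h : V → J ⊕ J → ℝ} (id : V ≃ J)
    (h1 : ∀ v w, h v (.inl (id w)) = ind (v = w)) (h2 : ∀ v w, h v (.inr (id w)) = ind (G.Adj v w))
    (a b : V) (l : List V) (hl : l.Nodup) (A : Finset V) (hA : ∀ u ∈ l, u ∉ A) :
    Recurrence.prefixSum (LinearMap.funLeft ℝ ℝ .inl) (LinearMap.funLeft ℝ ℝ Prod.fst) edgeInput
        (fun _ => -2) (indVec id A) (l.map h) (id a, id b) +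
      Recurrence.prefixSum (LinearMap.funLeft ℝ ℝ .inl) (LinearMap.funLeft ℝ ℝ Prod.fst) edgeInput
        (fun _ => -2) (indVec id A) (l.map h) (id b, id a) =
    ind (G.Adj a b) * (ind ((a ∈ A ∨ a ∈ l) ∧ (b ∈ A ∨ b ∈ l)) - ind (a ∈ A ∧ b ∈ A)) := by
  induction l generalizing A with
  | nil => simp [Recurrence.prefixSum]
  | cons u l ih =>
    have hu : u ∉ A := hA u (by simp)
    have hul : u ∉ l := (List.nodup_cons.mp hl).1
    have hS : indVec id A + LinearMap.funLeft ℝ ℝ .inl (h u) = indVec id (insert u A) :=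
      indVec_insert id hu (h1 u)
    have ih := ih (List.nodup_cons.mp hl).2 (insert u A) fun w hw => by
      rw [Finset.mem_insert, not_or]
      exact ⟨fun e => hul (e ▸ hw), hA w (by simp [hw])⟩
    rw [List.map_cons, Recurrence.prefixSum, hS, Pi.add_apply _ _ (id a, id b),
      Pi.add_apply _ _ (id b, id a), add_add_add_comm, ih]
    simp only [edgeInput, LinearMap.add_apply, LinearMap.funLeft_apply, Pi.add_apply, h1, h2,
      indVec_apply, Finset.mem_insert, List.mem_cons]
    by_cases c1 : u = a
    · subst c1
      by_cases c2 : u = b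
      · subst c2
        simp [ind, hu]
      · have c2' : b ≠ u := Ne.symm c2
        by_cases c3 : G.Adj u b <;> by_cases c4 : b ∈ A <;> by_cases c5 : b ∈ l <;>
          simp [ind, hu, hul, c2, c2', c3, c4, c5] <;> norm_num
    · have c1' : a ≠ u := Ne.symm c1
      by_cases c2 : u = b
      · subst c2
        have c3' := G.adj_comm u a
        by_cases c3 : G.Adj a u <;> by_cases c4 : a ∈ A <;> by_cases c5 : a ∈ l <;>
          simp [ind, hu, hul, c1, c1', c3, c3', c4, c5] <;> norm_num
      · have c2' : b ≠ u := Ne.symm c2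
        have m1 : ∀ (p q : Prop) [Decidable p] [Decidable q],
            max (ind p + (0 + ind q) + -2) 0 = 0 := fun p q _ _ => by
          unfold ind
          split_ifs <;> norm_num
        have z1 : ind (u = a) = 0 := if_neg c1
        have z2 : ind (u = b) = 0 := if_neg c2
        rw [z1, z2, m1, m1]
        simp [c1', c2']

variable [Fintype J]

theorem IsIdent.norm_le {G : SimpleGraph V} {h : V → J → ℝ} (hh : IsIdent G h) (v : V) :
    ‖h v‖ ≤ 1 := by
  obtain ⟨id, h1⟩ := hh
  refine norm_le_one_of_forall fun j => ?_
  obtain ⟨w, rfl⟩ := id.surjective j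
  exact ⟨_, _, h1 v w⟩

theorem IsAdj.norm_le {G : SimpleGraph V} {h : V → J ⊕ J → ℝ} (hh : IsAdj G h) (v : V) :
    ‖h v‖ ≤ 1 := by
  obtain ⟨id, h1, h2⟩ := hh
  refine norm_le_one_of_forall fun j => ?_
  rcases j with j | j <;> obtain ⟨w, rfl⟩ := id.surjective j
  exacts [⟨_, _, h1 v w⟩, ⟨_, _, h2 v w⟩]

theorem IsNbrAdj.norm_le {G : SimpleGraph V} {h : V → J ⊕ J × J → ℝ} (hh : IsNbrAdj G h) (v : V) :
    ‖h v‖ ≤ 1 := by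
  obtain ⟨id, h1, h2⟩ := hh
  refine norm_le_one_of_forall fun j => ?_
  rcases j with j | ⟨i, j⟩
  · obtain ⟨w, rfl⟩ := id.surjective j
    exact ⟨_, _, h1 v w⟩
  · obtain ⟨w, rfl⟩ := id.surjective j
    obtain ⟨a, rfl⟩ := id.surjective i
    exact ⟨_, _, h2 v a w⟩

variable [Fintype V]

/-- A layer collecting the identifiers of the neighbours. -/
theorem exists_realizes_isAdj : ∃ Φ : SimpleGraph V → (V → J → ℝ) → V → J ⊕ J → ℝ,
    Realizes F IsIdent Φ ∧ ∀ G h, IsIdent G h → IsAdj G (Φ G h) := by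
  classical
  refine ⟨_, Recurrence.realizes_linearMessages ⟨1, fun _ _ h => h.norm_le⟩
    (LinearMap.pi <| Sum.elim 0 LinearMap.proj) (LinearMap.pi <| Sum.elim LinearMap.proj 0) 0, ?_⟩
  rintro G h ⟨id, hid⟩
  refine ⟨id, fun v w => ?_, fun v w => ?_⟩
  · simp [hid]
  · simp [hid, ind, Finset.sum_ite_eq', Finset.mem_filter]

/-- A layer finding the edges between the neighbours of each node. -/
theorem exists_realizes_isNbrAdj : ∃ Φ : SimpleGraph V → (V → J ⊕ J → ℝ) → V → J ⊕ J × J → ℝ,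
    Realizes F IsAdj Φ ∧ ∀ G h, IsAdj G h → IsNbrAdj G (Φ G h) := by
  classical
  let T : SimpleGraph V → (V → J ⊕ J → ℝ) → V → J ⊕ J × J → ℝ := fun G h v => Sum.elim 0 fun p =>
    ∑ a, ∑ b, ind (G.Adj v a ∧ G.Adj v b ∧ G.Adj a b) * (h a (.inl p.1) * h b (.inl p.2))
  have hT : ∀ (G : SimpleGraph V) (h : V → J ⊕ J → ℝ) (id : V ≃ J),
      (∀ v w, h v (.inl (id w)) = ind (v = w)) → ∀ v a b,
      T G h v (.inr (id a, id b)) = ind (G.Adj v a ∧ G.Adj v b ∧ G.Adj a b) := by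
    intro G h id h1 v a b
    have e : ∀ a' b', ind (G.Adj v a' ∧ G.Adj v b' ∧ G.Adj a' b') *
        (h a' (.inl (id a)) * h b' (.inl (id b))) =
        if a' = a then (if b' = b then ind (G.Adj v a ∧ G.Adj v b ∧ G.Adj a b) else 0) else 0 := by
      intro a' b'
      rw [h1, h1]
      by_cases ha : a' = a <;> by_cases hb : b' = b <;> simp [ind, ha, hb]
    simp [T, e]
  refine ⟨_, Recurrence.realizes_prefixSum (T := T) ⟨1, fun _ _ h => h.norm_le⟩
    (LinearMap.funLeft ℝ ℝ .inl) (LinearMap.funLeft ℝ ℝ Prod.fst) edgeInput (fun _ => -2)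
    (LinearMap.pi <| Sum.elim 0 fun p =>
      LinearMap.proj (R := ℝ) (φ := fun _ : J × J => ℝ) (p.1, p.2) + LinearMap.proj (p.2, p.1))
    ?_ ?_ (LinearMap.pi <| Sum.elim (fun j => LinearMap.proj (.inl j)) 0) 0, ?_⟩
  · rintro G h ⟨id, h1, -⟩ v j
    obtain ⟨w, rfl⟩ := id.surjective j
    rw [LinearMap.funLeft_apply, h1, ind]
    split_ifs <;> simp
  · rintro G h ⟨id, h1, h2⟩ v l hl
    funext i
    rcases i with i | ⟨i, j⟩
    · simp [T]
    · obtain ⟨a, rfl⟩ := id.surjective i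
      obtain ⟨b, rfl⟩ := id.surjective j
      have h0 : (0 : J → ℝ) = indVec id (∅ : Finset V) := by
        funext i
        simp [indVec, ind]
      rw [hT G h id h1, h0]
      refine (prefixSum_edge id h1 h2 a b l hl.1 ∅ (by simp)).trans ?_
      simp only [Finset.notMem_empty, false_or, hl.2, ind, false_and, if_false, sub_zero]
      by_cases c1 : G.Adj a b <;> by_cases c2 : G.Adj v a <;> simp [c1, c2]
  · rintro G h ⟨id, h1, h2⟩
    refine ⟨id, fun v w => ?_, fun v a b => ?_⟩
    · simp [T, h1]
    · simp [hT G h id h1]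

/-- The contribution of the neighbours read before to the messages in the layer that finds the
triangles among the neighbours: the pair `(i, j)` counts how many of `i` and `j` have been read. -/
def triangleState : (J → ℝ) →ₗ[ℝ] (J × J → ℝ) :=
  LinearMap.funLeft ℝ ℝ Prod.fst + LinearMap.funLeft ℝ ℝ Prod.snd

open Classical in
/-- Each triangle among the neighbours is found twice, when the last of its vertices is read. -/
theorem prefixSum_triangle {G : SimpleGraph V} {h : V → J ⊕ J × J → ℝ} (id : V ≃ J)
    (h1 : ∀ v w, h v (.inl (id w)) = ind (v = w))
    (h2 : ∀ v a b, h v (.inr (id a, id b)) = ind (G.Adj v a ∧ G.Adj v b ∧ G.Adj a b))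
    (l : List V) (hl : l.Nodup) (A : Finset V) (hA : ∀ u ∈ l, u ∉ A) :
    ∑ p, Recurrence.prefixSum (LinearMap.funLeft ℝ ℝ .inl) triangleState
        (LinearMap.funLeft ℝ ℝ .inr) (fun _ => -2) (indVec id A) (l.map h) p =
      2 * (cliquesIn G 3 (A ∪ l.toFinset) - cliquesIn G 3 A) := by
  induction l generalizing A with
  | nil => simp [Recurrence.prefixSum]
  | cons u l ih =>
    have hu : u ∉ A := hA u (by simp)
    have hul : u ∉ l := (List.nodup_cons.mp hl).1
    have hS : indVec id A + LinearMap.funLeft ℝ ℝ .inl (h u) = indVec id (insert u A) :=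
      indVec_insert id hu (h1 u)
    have ih := ih (List.nodup_cons.mp hl).2 (insert u A) fun w hw => by
      rw [Finset.mem_insert, not_or]
      exact ⟨fun e => hul (e ▸ hw), hA w (by simp [hw])⟩
    simp only [List.map_cons, Recurrence.prefixSum, hS, Pi.add_apply, Finset.sum_add_distrib, ih]
    have hstep : ∑ p : J × J, max (triangleState (indVec id A) p +
        LinearMap.funLeft ℝ ℝ .inr (h u) p + -2) 0 =
        2 * cliquesIn G 2 (A.filter fun w => G.Adj u w) := by
      have hA' : (A.filter fun w => G.Adj u w) =
          ({w | w ∈ A ∧ G.Adj u w} : Finset V) := by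
        ext w
        simp
      rw [← sum_adj_eq_two_mul, hA', sum_filter_filter, ← (id.prodCongr id).sum_comp,
        Fintype.sum_prod_type]
      refine Finset.sum_congr rfl fun a _ => ?_
      refine Finset.sum_congr rfl fun b _ => ?_
      simp only [triangleState, Equiv.prodCongr_apply, Prod.map, LinearMap.add_apply,
        Pi.add_apply, LinearMap.funLeft_apply, indVec_apply, h2]
      by_cases c1 : a ∈ A <;> by_cases c2 : b ∈ A <;> by_cases c3 : G.Adj u a <;>
        by_cases c4 : G.Adj u b <;> by_cases c5 : G.Adj a b <;>
        simp [ind, c1, c2, c3, c4, c5] <;> norm_num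
    rw [hstep, cliquesIn_succ_insert G 2 hu, List.toFinset_cons, Finset.insert_union,
      Finset.union_insert]
    push_cast
    ring

/-- A layer computing the numbers of triangles and of 4-cliques at each node. -/
theorem realizes_isNbrAdj_cliques :
    Realizes F (IsNbrAdj (V := V) (J := J)) fun G _ v =>
      ![(incidenceCliques G 3 v : ℝ), (incidenceCliques G 4 v : ℝ)] := by
  classical
  refine (Recurrence.realizes_prefixSum
    (T := fun G _ v => ![(0 : ℝ), (incidenceCliques G 4 v : ℝ)]) ⟨1, fun _ _ h => h.norm_le⟩
    (LinearMap.funLeft ℝ ℝ .inl) triangleState (LinearMap.funLeft ℝ ℝ .inr) (fun _ => -2)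
    (LinearMap.pi ![0, (2⁻¹ : ℝ) • ∑ p, LinearMap.proj p]) ?_ ?_
    (LinearMap.pi ![(2⁻¹ : ℝ) • ∑ p, LinearMap.proj (.inr p), 0]) 0).congr ?_
  · rintro G h ⟨id, h1, -⟩ v j
    obtain ⟨w, rfl⟩ := id.surjective j
    rw [LinearMap.funLeft_apply, h1, ind]
    split_ifs <;> simp
  · rintro G h ⟨id, h1, h2⟩ v l hl
    have h0 : (0 : J → ℝ) = indVec id (∅ : Finset V) := by
      funext i
      simp [indVec, ind]
    have hl' : ∅ ∪ l.toFinset = ({u | G.Adj v u} : Finset V) := by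
      ext u
      simp [hl.2]
    have key := prefixSum_triangle id h1 h2 l hl.1 ∅ (by simp)
    rw [hl', ← incidenceCliques_succ, cliquesIn_succ_empty] at key
    funext i
    fin_cases i
    · simp
    · simp [h0, key]
  · rintro G h ⟨id, h1, h2⟩
    funext v i
    have key : ∑ p, h v (.inr p) = 2 * incidenceCliques G 3 v := by
      rw [incidenceCliques_succ, ← sum_adj_eq_two_mul, sum_filter_filter,
        ← (id.prodCongr id).sum_comp, Fintype.sum_prod_type]
      refine Finset.sum_congr rfl fun a _ => ?_
      refine Finset.sum_congr rfl fun b _ => ?_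
      simp only [Equiv.prodCongr_apply, Prod.map, h2]
      by_cases c3 : G.Adj v a <;> by_cases c4 : G.Adj v b <;> simp [ind, c3, c4]
    fin_cases i
    · change (0 : ℝ) + ((2⁻¹ : ℝ) • ∑ p, LinearMap.proj (.inr p) :
        (J ⊕ J × J → ℝ) →ₗ[ℝ] ℝ) (h v) + 0 = _
      simp [key]
    · change (incidenceCliques G 4 v : ℝ) + (0 : ℝ) + 0 = _
      simp

/-- Three layers compute the numbers of triangles and of 4-cliques at each node from the
identifiers. The degrees in the input features are not needed. -/
theorem realizes_cliques : Realizes F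
    (fun (G : SimpleGraph V) h => ∃ ident, h = identifiedInput G ident) fun G _ v =>
      ![(incidenceCliques G 3 v : ℝ), (incidenceCliques G 4 v : ℝ)] := by
  obtain ⟨Φ, hΦ, hΦ'⟩ := exists_realizes_isAdj (F := F) (V := V) (J := Fin (Fintype.card V))
  obtain ⟨Ψ, hΨ, hΨ'⟩ := exists_realizes_isNbrAdj (F := F) (V := V) (J := Fin (Fintype.card V))
  refine (realizes_isNbrAdj_cliques.comp (hΨ.comp hΦ hΦ') fun G h hh => hΨ' G _ (hΦ' G h hh)).comp
    (Realizes.linear (LinearMap.funLeft ℝ ℝ Fin.succ)) ?_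
  rintro G _ ⟨ident, rfl⟩
  refine ⟨ident, fun v w => ?_⟩
  by_cases hvw : v = w
  · simp [identifiedInput, LinearMap.funLeft_apply, ind, hvw]
  · simp [identifiedInput, LinearMap.funLeft_apply, ind, hvw, Ne.symm hvw]

end CliqueNet

/-! ### Pairs of graphs that the Weisfeiler-Lehman test does not distinguish -/

theorem map_univ_val_eq {α β : Type*} [Fintype α] {f f' : α → β} (π : α ≃ α)
    (h : ∀ a, f a = f' (π a)) :
    Multiset.map f (Finset.univ : Finset α).val = Multiset.map f' (Finset.univ : Finset α).val := by
  have h1 : (Finset.univ : Finset α).val.map π = Finset.univ.val :=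
    congrArg Finset.val (Finset.map_univ_equiv π)
  rw [← Multiset.map_congr (f := f' ∘ π) rfl fun a _ => (h a).symm, ← Multiset.map_map, h1]

/-- A winning strategy in the bijective pebble game: related tuples have the same atomic type, each
component can be moved along a bijection that keeps tuples related, and some bijection relates each
tuple to its image. -/
theorem not_WLDistinguishes_of_rel {V : Type*} [Fintype V] {k : ℕ} {G G' : SimpleGraph V}
    (r : (Fin k → V) → (Fin k → V) → Prop)
    (h0 : ∀ s s', r s s' → ∀ i j, (s i = s j ↔ s' i = s' j) ∧
      (G.Adj (s i) (s j) ↔ G'.Adj (s' i) (s' j)))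
    (hstep : ∀ s s', r s s' → ∀ j, ∃ π : V ≃ V, ∀ u,
      r (Function.update s j u) (Function.update s' j (π u)))
    (hall : ∃ P : (Fin k → V) ≃ (Fin k → V), ∀ s, r s (P s)) : ¬ WLDistinguishes k G G' := by
  have key : ∀ t s s', r s s' → wlColor k G t s = wlColor k G' t s' := by
    intro t
    induction t with
    | zero =>
      intro s s' hs
      funext i j
      exact Prod.ext (propext (h0 s s' hs i j).1) (propext (h0 s s' hs i j).2)
    | succ t ih =>
      intro s s' hs
      refine Prod.ext (ih s s' hs) (funext fun j => ?_)
      obtain ⟨π, hπ⟩ := hstep s s' hs j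
      exact map_univ_val_eq π fun u => ih _ _ (hπ u)
  rintro ⟨t, ht⟩
  obtain ⟨P, hP⟩ := hall
  exact ht (map_univ_val_eq P fun s => key t _ _ (hP s))

open Classical in
/-- Two functions with equally large fibres agree up to a permutation of the domain. -/
theorem exists_equiv_of_card_fiber {V T : Type*} [Fintype V] [DecidableEq T] (p p' : V → T)
    (h : ∀ t, (Finset.univ.filter fun u => p u = t).card =
      (Finset.univ.filter fun u => p' u = t).card) : ∃ π : V ≃ V, ∀ u, p u = p' (π u) := by
  have e : ∀ t, {u // p u = t} ≃ {u // p' u = t} := fun t => Fintype.equivOfCardEq (by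
    rw [Fintype.card_subtype, Fintype.card_subtype]
    exact h t)
  refine ⟨(Equiv.sigmaFiberEquiv p).symm.trans
    ((Equiv.sigmaCongrRight e).trans (Equiv.sigmaFiberEquiv p')), fun u => ?_⟩
  exact (e (p u) ⟨u, rfl⟩).2.symm

open Classical in
/-- The relation of `u` to `x`: equal, adjacent, or neither. -/
noncomputable def adjCode {V : Type*} (G : SimpleGraph V) (x u : V) : Fin 3 :=
  if u = x then 0 else if G.Adj u x then 1 else 2

theorem adjCode_eq_iff {V V' : Type*} {G : SimpleGraph V} {G' : SimpleGraph V'} {x u : V}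
    {x' u' : V'} : adjCode G x u = adjCode G' x' u' ↔
      (u = x ↔ u' = x') ∧ (G.Adj u x ↔ G'.Adj u' x') := by
  have h1 : u = x → ¬ G.Adj u x := fun h => h ▸ G.irrefl
  have h2 : u' = x' → ¬ G'.Adj u' x' := fun h => h ▸ G'.irrefl
  unfold adjCode
  split_ifs <;> simp_all

theorem adjCode_eq_zero {V : Type*} {G : SimpleGraph V} {x u : V} : adjCode G x u = 0 ↔ u = x := by
  unfold adjCode
  split_ifs <;> simp_all

theorem adjCode_eq_one {V : Type*} {G : SimpleGraph V} {x u : V} :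
    adjCode G x u = 1 ↔ G.Adj u x := by
  have h1 : u = x → ¬ G.Adj u x := fun h => h ▸ G.irrefl
  unfold adjCode
  split_ifs <;> simp_all

theorem card_filter_eq_sum_adjCode {V : Type*} [Fintype V] (G : SimpleGraph V) (x : V)
    (p : V → Prop) [DecidablePred p] : (Finset.univ.filter p).card =
      ∑ i, (Finset.univ.filter fun u => p u ∧ adjCode G x u = i).card := by
  rw [Finset.card_eq_sum_card_fiberwise (f := adjCode G x) (t := Finset.univ) (by simp)]
  simp [Finset.filter_filter]

/-! #### Two dimensions -/

open Classical in
theorem exists_equiv_of_equitable {V T : Type*} [Fintype V] [DecidableEq T]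
    {G G' : SimpleGraph V} (c c' : V → T)
    (hcard : ∀ t, (Finset.univ.filter fun u => c u = t).card =
      (Finset.univ.filter fun u => c' u = t).card)
    (hadj : ∀ x x', c x = c' x' → ∀ t, (Finset.univ.filter fun u => c u = t ∧ G.Adj u x).card =
      (Finset.univ.filter fun u => c' u = t ∧ G'.Adj u x').card) (x x' : V) (hx : c x = c' x') :
    ∃ π : V ≃ V, ∀ u, c u = c' (π u) ∧ adjCode G x u = adjCode G' x' (π u) := by
  refine (exists_equiv_of_card_fiber (fun u => (c u, adjCode G x u))
    (fun u => (c' u, adjCode G' x' u)) ?_).imp fun π hπ u => Prod.ext_iff.mp (hπ u)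
  rintro ⟨t, i⟩
  simp only [Prod.mk.injEq]
  have h0 : (Finset.univ.filter fun u => c u = t ∧ adjCode G x u = 0).card =
      (Finset.univ.filter fun u => c' u = t ∧ adjCode G' x' u = 0).card := by
    simp only [adjCode_eq_zero]
    have e : ∀ (d : V → T) (y : V), (Finset.univ.filter fun u => d u = t ∧ u = y).card =
        if d y = t then 1 else 0 := by
      intro d y
      split_ifs with h
      · rw [Finset.card_eq_one]
        exact ⟨y, by ext u; simp; rintro rfl; exact h⟩
      · rw [Finset.card_eq_zero]
        ext u
        simp
        rintro h' rfl
        exact h h'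
    rw [e, e, hx]
  have h1 : (Finset.univ.filter fun u => c u = t ∧ adjCode G x u = 1).card =
      (Finset.univ.filter fun u => c' u = t ∧ adjCode G' x' u = 1).card := by
    simpa only [adjCode_eq_one] using hadj x x' hx t
  have h2 := hcard t
  rw [card_filter_eq_sum_adjCode G x, card_filter_eq_sum_adjCode G' x', Fin.sum_univ_three,
    Fin.sum_univ_three] at h2
  fin_cases i
  · exact h0
  · exact h1
  · change (Finset.univ.filter fun u => c u = t ∧ adjCode G x u = 2).card =
      (Finset.univ.filter fun u => c' u = t ∧ adjCode G' x' u = 2).card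
    omega

open Classical in
/-- 2-WL does not distinguish two graphs with colourings of the same histogram such that equally
coloured vertices have equally many neighbours of each colour. -/
theorem not_WLDistinguishes_two_of_equitable {V T : Type*} [Fintype V] [DecidableEq T]
    {G G' : SimpleGraph V}
    (c c' : V → T) (hcard : ∀ t, (Finset.univ.filter fun u => c u = t).card =
      (Finset.univ.filter fun u => c' u = t).card)
    (hadj : ∀ x x', c x = c' x' → ∀ t, (Finset.univ.filter fun u => c u = t ∧ G.Adj u x).card =
      (Finset.univ.filter fun u => c' u = t ∧ G'.Adj u x').card) : ¬ WLDistinguishes 2 G G' := by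
  have ext := exists_equiv_of_equitable c c' hcard hadj
  refine not_WLDistinguishes_of_rel
    (fun s s' => (∀ i, c (s i) = c' (s' i)) ∧ adjCode G (s 0) (s 1) = adjCode G' (s' 0) (s' 1))
    ?_ ?_ ?_
  · rintro s s' ⟨-, hs⟩ i j
    rw [adjCode_eq_iff] at hs
    fin_cases i <;> fin_cases j
    · simp
    · simpa [eq_comm, G.adj_comm, G'.adj_comm] using hs
    · simpa using hs
    · simp
  · rintro s s' ⟨hc, hs⟩ j
    fin_cases j
    · obtain ⟨π, hπ⟩ := ext (s 1) (s' 1) (hc 1)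
      refine ⟨π, fun u => ⟨fun i => ?_, ?_⟩⟩
      · fin_cases i
        · simpa using (hπ u).1
        · simpa using hc 1
      · have := (hπ u).2
        rw [adjCode_eq_iff] at this ⊢
        simpa [eq_comm, G.adj_comm, G'.adj_comm] using this
    · obtain ⟨π, hπ⟩ := ext (s 0) (s' 0) (hc 0)
      refine ⟨π, fun u => ⟨fun i => ?_, ?_⟩⟩
      · fin_cases i
        · simpa using hc 0
        · simpa using (hπ u).1
      · simpa using (hπ u).2
  · obtain ⟨π, hπ⟩ := exists_equiv_of_card_fiber c c' hcard
    choose ρ hρ using fun x => ext x (π x) (hπ x)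
    refine ⟨(finTwoArrowEquiv V).trans ((π.prodShear ρ).trans (finTwoArrowEquiv V).symm),
      fun s => ⟨fun i => ?_, ?_⟩⟩
    · fin_cases i
      · simpa using hπ (s 0)
      · simpa using (hρ (s 0) (s 1)).1
    · simpa using (hρ (s 0) (s 1)).2

/-! #### Three dimensions -/

open Classical in
theorem card_adjCode {V : Type*} [Fintype V] {G : SimpleGraph V} {n k l m : ℕ}
    (h : G.IsSRGWith n k l m) (x : V) (i : Fin 3) :
    (Finset.univ.filter fun u => adjCode G x u = i).card = ![1, k, n - 1 - k] i := by
  have h0 : (Finset.univ.filter fun u => adjCode G x u = 0).card = 1 := by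
    rw [Finset.card_eq_one]
    exact ⟨x, by ext u; simp [adjCode_eq_zero]⟩
  have h1 : (Finset.univ.filter fun u => adjCode G x u = 1).card = k := by
    rw [Finset.filter_congr fun u _ => adjCode_eq_one, ← h.regular x,
      ← SimpleGraph.card_neighborFinset_eq_degree]
    congr 1
    ext u
    simp [G.adj_comm]
  have h2 := card_filter_eq_sum_adjCode G x fun _ => True
  simp only [true_and, Finset.filter_true, Finset.card_univ, h.card, Fin.sum_univ_three, h0, h1]
    at h2
  fin_cases i
  · exact h0
  · exact h1
  · change (Finset.univ.filter fun u => adjCode G x u = 2).card = n - 1 - k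
    omega

open Classical in
theorem card_adjCode_zero {V : Type*} [Fintype V] {G : SimpleGraph V} (x y : V) (i : Fin 3) :
    (Finset.univ.filter fun u => adjCode G x u = 0 ∧ adjCode G y u = i).card =
      if adjCode G y x = i then 1 else 0 := by
  simp only [adjCode_eq_zero]
  split_ifs with h
  · rw [Finset.card_eq_one]
    exact ⟨x, by ext u; simp; rintro rfl; exact h⟩
  · rw [Finset.card_eq_zero]
    ext u
    simp
    rintro rfl
    exact h

open Classical in
theorem card_adjCode_one_one {V : Type*} [Fintype V] {G : SimpleGraph V} {n k l m : ℕ}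
    (h : G.IsSRGWith n k l m) (x y : V) :
    (Finset.univ.filter fun u => adjCode G x u = 1 ∧ adjCode G y u = 1).card =
      ![k, l, m] (adjCode G y x) := by
  by_cases hxy : x = y
  · subst hxy
    have h0 : adjCode G x x = 0 := adjCode_eq_zero.mpr rfl
    simpa only [and_self, h0, Matrix.cons_val_zero, Matrix.cons_val_one] using card_adjCode h x 1
  have e : (Finset.univ.filter fun u => adjCode G x u = 1 ∧ adjCode G y u = 1).card =
      Fintype.card (G.commonNeighbors x y) := by
    rw [← Set.toFinset_card]
    congr 1
    ext u
    simp [adjCode_eq_one, SimpleGraph.mem_commonNeighbors, G.adj_comm]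
  by_cases hadj : G.Adj x y
  · rw [e, h.of_adj x y hadj]
    simp [adjCode, hxy, hadj]
  · rw [e, h.of_not_adj hxy hadj]
    simp [adjCode, hxy, hadj]

open Classical in
/-- Pairs of vertices in the same relation have extensions by a third vertex in bijection. -/
theorem exists_equiv_of_isSRGWith {V : Type*} [Fintype V] {G G' : SimpleGraph V} {n k l m : ℕ}
    (h : G.IsSRGWith n k l m) (h' : G'.IsSRGWith n k l m) (x y x' y' : V)
    (hxy : adjCode G y x = adjCode G' y' x') : ∃ π : V ≃ V, ∀ u,
      adjCode G x u = adjCode G' x' (π u) ∧ adjCode G y u = adjCode G' y' (π u) := by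
  have hyx : adjCode G x y = adjCode G' x' y' := by
    rw [adjCode_eq_iff] at hxy ⊢
    simpa [eq_comm, G.adj_comm, G'.adj_comm] using hxy
  refine (exists_equiv_of_card_fiber (fun u => (adjCode G x u, adjCode G y u))
    (fun u => (adjCode G' x' u, adjCode G' y' u)) ?_).imp fun π hπ u => Prod.ext_iff.mp (hπ u)
  -- The nine numbers of vertices in given relations to `x` and `y` are determined by their row
  -- and column sums together with the first row, the first column and the middle entry.
  set f : Fin 3 → Fin 3 → ℕ := fun i j =>
    (Finset.univ.filter fun u => adjCode G x u = i ∧ adjCode G y u = j).card with hf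
  set f' : Fin 3 → Fin 3 → ℕ := fun i j =>
    (Finset.univ.filter fun u => adjCode G' x' u = i ∧ adjCode G' y' u = j).card with hf'
  have row : ∀ i, f i 0 + f i 1 + f i 2 = f' i 0 + f' i 1 + f' i 2 := by
    intro i
    have e := card_filter_eq_sum_adjCode G y fun u => adjCode G x u = i
    have e' := card_filter_eq_sum_adjCode G' y' fun u => adjCode G' x' u = i
    rw [card_adjCode h, Fin.sum_univ_three] at e
    rw [card_adjCode h', Fin.sum_univ_three] at e'
    exact e.symm.trans e'
  have col : ∀ j, f 0 j + f 1 j + f 2 j = f' 0 j + f' 1 j + f' 2 j := by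
    intro j
    have e := card_filter_eq_sum_adjCode G x fun u => adjCode G y u = j
    have e' := card_filter_eq_sum_adjCode G' x' fun u => adjCode G' y' u = j
    rw [card_adjCode h, Fin.sum_univ_three] at e
    rw [card_adjCode h', Fin.sum_univ_three] at e'
    simp only [and_comm (a := adjCode _ y _ = _)] at e
    simp only [and_comm (a := adjCode _ y' _ = _)] at e'
    exact e.symm.trans e'
  have hrow : ∀ j, f 0 j = f' 0 j := fun j => by
    rw [hf, hf']
    simp only [card_adjCode_zero, hxy]
  have hcol : ∀ i, f i 0 = f' i 0 := fun i => by
    rw [hf, hf']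
    simp only [and_comm (b := adjCode _ _ _ = 0), card_adjCode_zero, hyx]
  have hmid : f 1 1 = f' 1 1 := by
    rw [hf, hf']
    simp only [card_adjCode_one_one h, card_adjCode_one_one h', hxy]
  rintro ⟨i, j⟩
  simp only [Prod.mk.injEq]
  change f i j = f' i j
  have r1 := row 1
  have r2 := row 2
  have c1 := col 1
  have c2 := col 2
  have := hrow 0
  have := hrow 1
  have := hrow 2
  have := hcol 1
  have := hcol 2
  fin_cases i <;> fin_cases j <;>
    simp only [Fin.zero_eta, Fin.mk_one, Fin.reduceFinMk] <;> omega

/-- 3-WL does not distinguish strongly regular graphs with the same parameters. -/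
theorem not_WLDistinguishes_three_of_isSRGWith {V : Type*} [Fintype V] [DecidableEq V]
    {G G' : SimpleGraph V} [DecidableRel G.Adj] [DecidableRel G'.Adj] {n k l m : ℕ}
    (h : G.IsSRGWith n k l m) (h' : G'.IsSRGWith n k l m) : ¬ WLDistinguishes 3 G G' := by
  have symm : ∀ {x y x' y'}, adjCode G y x = adjCode G' y' x' →
      adjCode G x y = adjCode G' x' y' := by
    intro x y x' y' hxy
    rw [adjCode_eq_iff] at hxy ⊢
    simpa [eq_comm, G.adj_comm, G'.adj_comm] using hxy
  have hself : ∀ x x', adjCode G x x = adjCode G' x' x' := fun x x' => by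
    rw [adjCode_eq_iff]
    simp
  have ext : ∀ x y x' y', adjCode G y x = adjCode G' y' x' → ∃ π : V ≃ V, ∀ u,
      adjCode G x u = adjCode G' x' (π u) ∧ adjCode G y u = adjCode G' y' (π u) := by
    intro x y x' y' hxy
    refine exists_equiv_of_isSRGWith (n := n) (k := k) (l := l) (m := m) ?_ ?_ x y x' y' hxy
    · convert h
    · convert h'
  refine not_WLDistinguishes_of_rel
    (fun s s' => ∀ i j, adjCode G (s i) (s j) = adjCode G' (s' i) (s' j)) ?_ ?_ ?_
  · intro s s' hs i j
    exact adjCode_eq_iff.mp (symm (hs i j))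
  · intro s s' hs j
    -- The two components of the tuple other than the `j`-th one.
    obtain ⟨a, b, hab⟩ : ∃ a b : Fin 3, ∀ i, i ≠ j → i = a ∨ i = b := by
      fin_cases j
      exacts [⟨1, 2, by decide⟩, ⟨0, 2, by decide⟩, ⟨0, 1, by decide⟩]
    obtain ⟨π, hπ⟩ := ext (s a) (s b) (s' a) (s' b) (hs b a)
    have hu : ∀ u i, i ≠ j → adjCode G (s i) u = adjCode G' (s' i) (π u) := by
      intro u i hi
      rcases hab i hi with rfl | rfl
      exacts [(hπ u).1, (hπ u).2]
    refine ⟨π, fun u i i' => ?_⟩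
    by_cases hi : i = j <;> by_cases hi' : i' = j
    · simpa [hi, hi'] using hself _ _
    · simpa [hi, hi'] using symm (hu u i' hi')
    · simpa [hi, hi'] using hu u i hi
    · simpa [hi, hi'] using hs i i'
  · choose ρ hρ using fun x => ext x x x x (hself x x)
    choose τ hτ using fun x y => ext x y x (ρ x y) (symm (hρ x y).1)
    let e : (Fin 3 → V) ≃ V × V × V :=
      { toFun := fun s => (s 0, s 1, s 2)
        invFun := fun p => ![p.1, p.2.1, p.2.2]
        left_inv := fun s => by
          funext i
          fin_cases i <;> rfl
        right_inv := fun p => rfl }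
    refine ⟨e.trans (((Equiv.refl V).prodShear fun x => (ρ x).prodShear (τ x)).trans e.symm),
      fun s i j => ?_⟩
    have h01 := (hρ (s 0) (s 1)).1
    have h02 := (hτ (s 0) (s 1) (s 2)).1
    have h12 := (hτ (s 0) (s 1) (s 2)).2
    fin_cases i <;> fin_cases j
    exacts [hself _ _, h01, h02, symm h01, hself _ _, h12, symm h02, symm h12, hself _ _]

/-! ### Colour refinement by networks -/

/-- On the integers up to `L`, every function is computed by one hidden layer of rectifiers. -/
theorem exists_relu_interpolation (L : ℕ) (φ : ℕ → ℝ) :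
    ∃ (W : (Unit → ℝ) →ₗ[ℝ] (Fin (L + 1) × Fin 3 → ℝ)) (b : Fin (L + 1) × Fin 3 → ℝ)
      (P : (Fin (L + 1) × Fin 3 → ℝ) →ₗ[ℝ] (Unit → ℝ)),
      ∀ s ≤ L, (P fun p => max ((W (fun _ => (s : ℝ)) + b) p) 0) = fun _ => φ s := by
  -- On integers, `max (s - t + 1) 0 - 2 * max (s - t) 0 + max (s - t - 1) 0` is `1` if `s = t`, and
  -- `0` otherwise.
  refine ⟨LinearMap.pi fun _ => LinearMap.proj (), fun p => 1 - p.1 - p.2,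
    LinearMap.pi fun _ => ∑ t : Fin (L + 1), φ t • (LinearMap.proj (t, 0) -
      (2 : ℝ) • LinearMap.proj (t, 1) + LinearMap.proj (t, 2)), fun s hs => ?_⟩
  have hat : ∀ t : ℕ, max ((s : ℝ) + (1 - t)) 0 - 2 * max ((s : ℝ) + (1 - t - 1)) 0 +
      max ((s : ℝ) + (1 - t - 2)) 0 = if s = t then 1 else 0 := by
    intro t
    rcases lt_trichotomy s t with h | h | h
    · have : (s : ℝ) + 1 ≤ t := by exact_mod_cast h
      rw [max_eq_right (by linarith), max_eq_right (by linarith), max_eq_right (by linarith),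
        if_neg h.ne]
      ring
    · subst h
      rw [max_eq_left (by linarith), max_eq_right (by linarith), max_eq_right (by linarith),
        if_pos rfl]
      ring
    · have : (t : ℝ) + 1 ≤ s := by exact_mod_cast h
      rw [max_eq_left (by linarith), max_eq_left (by linarith), max_eq_left (by linarith),
        if_neg h.ne']
      ring
  funext _
  have e : ∀ t : Fin (L + 1), (s = (t : ℕ)) ↔ (⟨s, by omega⟩ : Fin (L + 1)) = t := fun t => by
    rw [Fin.ext_iff]
  have : ∑ t : Fin (L + 1), φ t * (if s = (t : ℕ) then 1 else 0) = φ s := by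
    simp only [e, mul_ite, mul_one, mul_zero]
    simp
  rw [← this]
  simp only [LinearMap.pi_apply, LinearMap.sum_apply, LinearMap.smul_apply, LinearMap.add_apply,
    LinearMap.sub_apply, LinearMap.proj_apply, smul_eq_mul, Pi.add_apply, ← hat]
  refine Finset.sum_congr rfl fun t _ => ?_
  simp

/-- Uniqueness of digits in base `b`. -/
theorem eq_of_sum_mul_pow_eq {b : ℕ} (n : ℕ) (c d : ℕ → ℕ) (hc : ∀ t, c t < b) (hd : ∀ t, d t < b)
    (h : ∑ t ∈ Finset.range n, c t * b ^ t = ∑ t ∈ Finset.range n, d t * b ^ t) :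
    ∀ t < n, c t = d t := by
  induction n generalizing c d with
  | zero => simp
  | succ n ih =>
    have e : ∀ f : ℕ → ℕ, ∑ t ∈ Finset.range (n + 1), f t * b ^ t =
        f 0 + b * ∑ t ∈ Finset.range n, f (t + 1) * b ^ t := by
      intro f
      rw [Finset.sum_range_succ', Finset.mul_sum, add_comm]
      congr 1
      · simp
      · exact Finset.sum_congr rfl fun t _ => by ring
    rw [e, e] at h
    have h0 : c 0 = d 0 := by
      have := congrArg (· % b) h
      simpa [Nat.add_mul_mod_self_left, Nat.mod_eq_of_lt, hc, hd] using this
    have hb : 0 < b := (Nat.zero_le _).trans_lt (hc 0)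
    rw [h0] at h
    have h1 := ih (fun t => c (t + 1)) (fun t => d (t + 1)) (fun t => hc _) (fun t => hd _)
      (Nat.eq_of_mul_eq_mul_left hb (Nat.add_left_cancel h))
    intro t ht
    cases t with
    | zero => exact h0
    | succ t => exact h1 t (by omega)

/-- The sum of the powers `b ^ f u` over a set of fewer than `b` elements determines how often `f`
takes each value: the digits in base `b` are these numbers. -/
theorem card_fiber_eq_of_sum_pow_eq {V : Type*} {b L : ℕ} {A A' : Finset V} {f f' : V → ℕ}
    (hA : A.card < b) (hA' : A'.card < b) (hf : ∀ u, f u ≤ L) (hf' : ∀ u, f' u ≤ L)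
    (h : ∑ u ∈ A, b ^ f u = ∑ u ∈ A', b ^ f' u) (t : ℕ) :
    (A.filter fun u => f u = t).card = (A'.filter fun u => f' u = t).card := by
  have e : ∀ (A : Finset V) (f : V → ℕ), (∀ u, f u ≤ L) → ∑ u ∈ A, b ^ f u =
      ∑ t ∈ Finset.range (L + 1), (A.filter fun u => f u = t).card * b ^ t := by
    intro A f hf
    rw [← Finset.sum_fiberwise_of_maps_to (g := f) (t := Finset.range (L + 1))
      fun u _ => Finset.mem_range.mpr (Nat.lt_succ_of_le (hf u))]
    refine Finset.sum_congr rfl fun t _ => ?_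
    rw [Finset.sum_congr rfl fun u hu => by rw [(Finset.mem_filter.mp hu).2], Finset.sum_const,
      smul_eq_mul]
  rw [e A f hf, e A' f' hf'] at h
  by_cases ht : t < L + 1
  · exact eq_of_sum_mul_pow_eq (L + 1) _ _ (fun t => (Finset.card_filter_le _ _).trans_lt hA)
      (fun t => (Finset.card_filter_le _ _).trans_lt hA') h t ht
  · rw [Finset.filter_false_of_mem fun u _ => ?_, Finset.filter_false_of_mem fun u _ => ?_]
    · have := hf' u
      omega
    · have := hf u
      omega

namespace Refinement

variable (F : PGForm) {V : Type} [Fintype V]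

/-- All nodes have the constant feature `1`. -/
def IsOne (_ : SimpleGraph V) (h : V → Fin 1 → ℝ) : Prop := h = fun _ _ => 1

/-- On constant input features, networks of the form `F` realize the real-valued node invariant `g`
of all graphs with vertex set `V`. -/
def Computes (g : SimpleGraph V → V → ℝ) : Prop :=
  Realizes F IsOne fun G _ v (_ : Unit) => g G v

variable {F}

theorem exists_bound (f : SimpleGraph V → V → ℕ) : ∃ L, ∀ G v, f G v ≤ L := by
  obtain ⟨L, hL⟩ := (Set.finite_range fun p : SimpleGraph V × V => f p.1 p.2).bddAbove
  exact ⟨L, fun G v => hL ⟨(G, v), rfl⟩⟩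

open Classical in
/-- Arbitrary functions of natural-valued colours can be sent as messages, since the colours take
only finitely many values. -/
theorem Computes.messages {f : SimpleGraph V → V → ℕ} (hf : Computes F fun G v => (f G v : ℝ))
    (φ : ℕ → ℝ) (a : ℝ) :
    Computes F fun G v => (∑ u with G.Adj v u, φ (f G u)) + a * f G v := by
  obtain ⟨L, hL⟩ := exists_bound f
  obtain ⟨W, b, P, hP⟩ := exists_relu_interpolation L φ
  refine ((Recurrence.realizes_messages (D := fun G h => h = fun v _ => (f G v : ℝ))
    ⟨L, ?_⟩ W b P (a • LinearMap.id) 0).comp hf fun _ _ _ => rfl).congr ?_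
  · rintro G _ rfl v
    refine (pi_norm_le_iff_of_nonneg (Nat.cast_nonneg _)).mpr fun _ => ?_
    simpa using hL G v
  · intro G h _
    funext v i
    have key : ∀ u, (P fun p => max ((W (fun _ => (f G u : ℝ)) + b) p) 0) = fun _ => φ (f G u) :=
      fun u => hP _ (hL G u)
    simp only [key]
    simp

/-- Some colouring by natural numbers of the nodes of all graphs with vertex set `V` is computed by
networks and equitable: nodes of the same colour, even of different graphs, have equally many
neighbours of each colour. -/
theorem exists_equitable : ∃ f : SimpleGraph V → V → ℕ, Computes F (fun G v => (f G v : ℝ)) ∧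
    open Classical in ∀ G G' x x', f G x = f G' x' → ∀ t,
      (({u | G.Adj x u} : Finset V).filter fun u => f G u = t).card =
      (({u | G'.Adj x' u} : Finset V).filter fun u => f G' u = t).card := by
  classical
  let cls : (SimpleGraph V → V → ℕ) → Set ℕ := fun f =>
    Set.range fun p : SimpleGraph V × V => f p.1 p.2
  have hfin : ∀ f, (cls f).Finite := fun f => Set.finite_range _
  -- A colouring with the greatest possible number of colours is not refined any further.
  obtain ⟨f, hf, hmax⟩ : ∃ f : SimpleGraph V → V → ℕ, Computes F (fun G v => (f G v : ℝ)) ∧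
      ∀ f' : SimpleGraph V → V → ℕ, Computes F (fun G v => (f' G v : ℝ)) →
        (cls f').ncard ≤ (cls f).ncard := by
    let S : Set ℕ := {n | ∃ f : SimpleGraph V → V → ℕ,
      Computes F (fun G v => (f G v : ℝ)) ∧ (cls f).ncard = n}
    have hne : S.Nonempty := by
      refine ⟨_, fun _ _ => 1, ?_, rfl⟩
      refine (Realizes.linear (LinearMap.pi fun _ => LinearMap.proj 0)).congr ?_
      rintro G _ rfl
      funext v i
      simp
    have hbdd : BddAbove S := by
      refine ⟨Nat.card (SimpleGraph V × V), ?_⟩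
      rintro _ ⟨f, -, rfl⟩
      simpa [cls, Set.image_univ, Set.ncard_univ] using
        Set.ncard_image_le (f := fun p : SimpleGraph V × V => f p.1 p.2) Set.finite_univ
    obtain ⟨f, hf, hn⟩ := Nat.sSup_mem hne hbdd
    exact ⟨f, hf, fun f' hf' => hn ▸ le_csSup hbdd ⟨f', hf', rfl⟩⟩
  refine ⟨f, hf, ?_⟩
  obtain ⟨L, hL⟩ := exists_bound f
  let b := Fintype.card V + 1
  let m : SimpleGraph V → V → ℕ := fun G v => ∑ u with G.Adj v u, b ^ f G u
  obtain ⟨K, hK⟩ := exists_bound m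
  let f' : SimpleGraph V → V → ℕ := fun G v => m G v + (K + 1) * f G v
  have hf' : Computes F (fun G v => (f' G v : ℝ)) := by
    refine (hf.messages (fun s => (b : ℝ) ^ s) (K + 1)).congr fun G h _ => ?_
    funext v i
    simp [f', m]
  have hdiv : ∀ G v, f' G v / (K + 1) = f G v := fun G v => by
    rw [Nat.add_mul_div_left _ _ (Nat.succ_pos K),
      Nat.div_eq_of_lt (Nat.lt_succ_of_le (hK G v)), zero_add]
  have himg : (fun n => n / (K + 1)) '' cls f' = cls f := by
    rw [← Set.range_comp]
    exact congrArg Set.range (funext fun p => hdiv p.1 p.2)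
  have hinj : Set.InjOn (fun n => n / (K + 1)) (cls f') := by
    refine Set.injOn_of_ncard_image_eq ?_ (hfin f')
    refine le_antisymm (Set.ncard_image_le (hfin f')) ?_
    rw [himg]
    exact hmax f' hf'
  intro G G' x x' hx t
  have hm : f' G x = f' G' x' := hinj ⟨(G, x), rfl⟩ ⟨(G', x'), rfl⟩ (by
    simp only [hdiv, hx])
  simp only [f', hx, Nat.add_right_cancel_iff] at hm
  exact card_fiber_eq_of_sum_pow_eq (Nat.lt_succ_of_le (Finset.card_le_univ _))
    (Nat.lt_succ_of_le (Finset.card_le_univ _)) (hL G) (hL G') hm t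

/-- An invariant with different sums over the nodes of two graphs distinguishes them. -/
theorem Computes.distinguishes {g : SimpleGraph V → V → ℝ} (hg : Computes F g)
    {G G' : SimpleGraph V} (h : ∑ v, g G v ≠ ∑ v, g G' v) :
    PGDistinguishes F G G' ∧ PGDistinguishesAnonymous F G G' := by
  let δ : (Unit → ℝ) →ₗ[ℝ] (Fin 1 → ℝ) := LinearMap.pi fun _ => LinearMap.proj ()
  have hg' := hg.linear_comp δ
  constructor
  -- The identifier of a node is a unit vector, so that its coordinates add up to the constant `1`.
  · have hone := hg'.comp (D := fun (G : SimpleGraph V) h => ∃ ident, h = identifiedInput G ident)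
      (Realizes.linear (LinearMap.pi fun _ => ∑ i : Fin (Fintype.card V), LinearMap.proj i.succ))
      (by
        rintro G _ ⟨ident, rfl⟩
        funext v i
        simp [identifiedInput])
    obtain ⟨net, hnet⟩ := hone.exists_net
    refine ⟨1, net, fun ν ν' ident ident' e => h ?_⟩
    rw [net.graphScore_eq_sum, net.graphScore_eq_sum,
      Finset.sum_congr rfl fun v _ => hnet G ν _ ⟨ident, rfl⟩ v,
      Finset.sum_congr rfl fun v _ => hnet G' ν' _ ⟨ident', rfl⟩ v] at e
    simpa [δ] using congrFun e 0
  · obtain ⟨net, hnet⟩ := hg'.exists_net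
    refine ⟨1, net, fun ν ν' e => h ?_⟩
    rw [net.graphScore_eq_sum, net.graphScore_eq_sum,
      Finset.sum_congr rfl fun v _ => hnet G ν _ rfl v,
      Finset.sum_congr rfl fun v _ => hnet G' ν' _ rfl v] at e
    simpa [δ] using congrFun e 0

/-- If networks fail to distinguish two graphs, with or without identifiers, the histograms of an
equitable colouring agree, which contradicts `not_WLDistinguishes_two_of_equitable`. -/
theorem distinguishes_of_WLDistinguishes_two {G G' : SimpleGraph V} (h : WLDistinguishes 2 G G') :
    PGDistinguishes F G G' ∧ PGDistinguishesAnonymous F G G' := by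
  classical
  by_contra hnot
  have hsum : ∀ g, Computes F g → ∑ v, g G v = ∑ v, g G' v := fun g hg => by
    by_contra hne
    exact hnot (hg.distinguishes hne)
  obtain ⟨f, hf, heq⟩ := exists_equitable (F := F) (V := V)
  obtain ⟨L, hL⟩ := exists_bound f
  let d : SimpleGraph V → V → ℕ := fun G v => ({u | G.Adj v u} : Finset V).card
  have hd : ∀ G G' x x', f G x = f G' x' → d G x = d G' x' := by
    intro G G' x x' hx
    have e : ∀ G x, d G x = ∑ t ∈ Finset.range (L + 1),
        (({u | G.Adj x u} : Finset V).filter fun u => f G u = t).card := fun G x =>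
      Finset.card_eq_sum_card_fiberwise fun u _ =>
        Finset.mem_coe.mpr (Finset.mem_range.mpr (Nat.lt_succ_of_le (hL G u)))
    rw [e, e]
    exact Finset.sum_congr rfl fun t _ => heq G G' x x' hx t
  obtain ⟨δ, hδ⟩ : ∃ δ : ℕ → ℕ, ∀ G u, δ (f G u) = d G u := by
    refine ⟨fun s => if hs : ∃ p : SimpleGraph V × V, f p.1 p.2 = s then
      d hs.choose.1 hs.choose.2 else 0, fun G u => ?_⟩
    have hs : ∃ p : SimpleGraph V × V, f p.1 p.2 = f G u := ⟨(G, u), rfl⟩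
    beta_reduce
    rw [dif_pos hs]
    exact hd _ _ _ _ hs.choose_spec
  -- Summing messages over all nodes weights the colour of a node by its degree; the colour
  -- determines the degree, so that the weight can be divided out unless the node is isolated.
  have hhist : ∀ ψ : ℕ → ℝ, (∑ u with d G u ≠ 0, ψ (f G u)) = ∑ u with d G' u ≠ 0, ψ (f G' u) := by
    intro ψ
    have e : ∀ G : SimpleGraph V, ∑ v, ((∑ u with G.Adj v u,
        (fun s => (δ s : ℝ)⁻¹ * ψ s) (f G u)) + 0 * (f G v : ℝ)) =
        ∑ u with d G u ≠ 0, ψ (f G u) := by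
      intro G
      simp only [zero_mul, add_zero, Finset.sum_filter, hδ]
      rw [Finset.sum_comm]
      refine Finset.sum_congr rfl fun u _ => ?_
      rw [← Finset.sum_filter, Finset.sum_const, nsmul_eq_mul]
      have : (({v | G.Adj v u} : Finset V).card : ℝ) = d G u := by
        simp only [d, G.adj_comm]
      rw [this]
      split_ifs with h0
      · rw [mul_inv_cancel_left₀ (by exact_mod_cast h0)]
      · rw [not_not.mp h0]
        simp
    rw [← e, ← e]
    exact hsum _ (hf.messages (fun s => (δ s : ℝ)⁻¹ * ψ s) 0)
  -- Isolated nodes get a colour of their own.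
  let c : SimpleGraph V → V → ℕ := fun G u => if d G u = 0 then 0 else f G u + 1
  have hcard : ∀ t, (Finset.univ.filter fun u => c G u = t).card =
      (Finset.univ.filter fun u => c G' u = t).card := by
    intro t
    cases t with
    | zero =>
      have h1 := hhist fun _ => 1
      simp only [Finset.sum_const, nsmul_eq_mul, mul_one, Nat.cast_inj] at h1
      have e : ∀ G, (Finset.univ.filter fun u => c G u = 0).card +
          (Finset.univ.filter fun u => d G u ≠ 0).card = Fintype.card V := fun G => by
        have : (Finset.univ.filter fun u => c G u = 0) = Finset.univ.filter fun u => d G u = 0 := by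
          ext u
          by_cases h0 : d G u = 0 <;> simp [c, h0]
        rw [this, Finset.card_filter_add_card_filter_not, Finset.card_univ]
      have := e G
      have := e G'
      omega
    | succ t =>
      have h1 := hhist fun s => if s = t then 1 else 0
      have e : ∀ G, (Finset.univ.filter fun u => c G u = t + 1) =
          (Finset.univ.filter fun u => d G u ≠ 0).filter fun u => f G u = t := fun G => by
        ext u
        by_cases h0 : d G u = 0 <;> simp [c, h0]
      rw [e, e]
      simpa using h1
  have hadj : ∀ x x', c G x = c G' x' → ∀ t,
      (Finset.univ.filter fun u => c G u = t ∧ G.Adj u x).card =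
      (Finset.univ.filter fun u => c G' u = t ∧ G'.Adj u x').card := by
    intro x x' hx t
    have hpos : ∀ {G : SimpleGraph V} {u x}, G.Adj u x → d G u ≠ 0 := fun {G u x} hux =>
      Finset.card_ne_zero.mpr ⟨x, by simpa using hux⟩
    have e : ∀ (G : SimpleGraph V) x, (Finset.univ.filter fun u => c G u = t ∧ G.Adj u x) =
        ({u | G.Adj x u} : Finset V).filter fun u => f G u + 1 = t := fun G x => by
      ext u
      simp only [Finset.mem_filter, Finset.mem_univ, true_and, G.adj_comm x u,
        and_comm (a := c G u = t)]
      refine and_congr_right fun hux => ?_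
      rw [show c G u = f G u + 1 from if_neg (hpos hux)]
    rw [e, e]
    by_cases h0 : d G x = 0
    · have h0' : d G' x' = 0 := by
        by_contra h0'
        simp [c, h0, h0'] at hx
      rw [Finset.card_eq_zero.mp h0, Finset.card_eq_zero.mp h0']
      rfl
    · have h0' : d G' x' ≠ 0 := by
        intro h0'
        simp [c, h0, h0'] at hx
      have hfx : f G x = f G' x' := by simpa [c, h0, h0'] using hx
      cases t with
      | zero => simp
      | succ t => simpa only [Nat.add_right_cancel_iff] using heq G G' x x' hfx t
  exact not_WLDistinguishes_two_of_equitable (c G) (c G') hcard hadj h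

end Refinement

/-! ### The separating pairs of graphs -/

theorem CliqueNet.distinguishes {V : Type} [Fintype V] {F : PGForm} {G G' : SimpleGraph V}
    (h : ∑ v, incidenceCliques G 4 v ≠ ∑ v, incidenceCliques G' 4 v) : PGDistinguishes F G G' := by
  obtain ⟨net, hnet⟩ := (CliqueNet.realizes_cliques (F := F) (V := V)).exists_net
  refine ⟨2, net, fun ν ν' ident ident' e => h ?_⟩
  rw [net.graphScore_eq_sum, net.graphScore_eq_sum,
    Finset.sum_congr rfl fun v _ => hnet G ν _ ⟨ident, rfl⟩ v,
    Finset.sum_congr rfl fun v _ => hnet G' ν' _ ⟨ident', rfl⟩ v] at e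
  have e1 := congrFun e 1
  simp only [Finset.sum_apply, Matrix.cons_val_one, Matrix.cons_val_fin_one] at e1
  exact_mod_cast e1

theorem sum_incidenceCliques_eq_zero {V : Type*} [Fintype V] {G : SimpleGraph V} {m : ℕ}
    (h : G.CliqueFree m) : ∑ v, incidenceCliques G m v = 0 := by
  refine Finset.sum_eq_zero fun v _ => ?_
  rw [incidenceCliques, Set.ncard_eq_zero (Set.toFinite _)]
  ext s
  simpa using fun _ => h s

theorem sum_incidenceCliques_pos {V : Type*} [Fintype V] {G : SimpleGraph V} {m : ℕ}
    {s : Finset V} (hs : G.IsNClique m s) {v : V} (hv : v ∈ s) :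
    0 < ∑ v, incidenceCliques G m v := by
  refine Finset.sum_pos' (fun _ _ => Nat.zero_le _) ⟨v, Finset.mem_univ v, ?_⟩
  exact (Set.ncard_pos (Set.toFinite _)).mpr ⟨s, hv, hs⟩

/-- Two disjoint copies of `K₄`. -/
def twoK4 : SimpleGraph (Fin 8) where
  Adj a b := a ≠ b ∧ (a.val < 4 ↔ b.val < 4)
  symm := ⟨fun _ _ h => ⟨h.1.symm, h.2.symm⟩⟩
  loopless := ⟨fun _ h => h.1 rfl⟩

/-- The Möbius ladder with 8 vertices, a cubic graph without triangles. -/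
def moebiusLadder : SimpleGraph (Fin 8) where
  Adj a b := b - a = 1 ∨ b - a = 7 ∨ b - a = 4
  symm := ⟨by decide⟩
  loopless := ⟨by decide⟩

instance : DecidableRel twoK4.Adj := fun a b =>
  inferInstanceAs (Decidable (a ≠ b ∧ (a.val < 4 ↔ b.val < 4)))

instance : DecidableRel moebiusLadder.Adj := fun a b =>
  inferInstanceAs (Decidable (b - a = 1 ∨ b - a = 7 ∨ b - a = 4))

theorem not_WLDistinguishes_twoK4_moebiusLadder : ¬ WLDistinguishes 2 twoK4 moebiusLadder := by
  have h1 : ∀ x, (Finset.univ.filter fun u => twoK4.Adj u x).card = 3 := by decide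
  have h2 : ∀ x, (Finset.univ.filter fun u => moebiusLadder.Adj u x).card = 3 := by decide
  refine not_WLDistinguishes_two_of_equitable (fun _ => ()) (fun _ => ()) (fun _ => rfl)
    fun x x' _ t => ?_
  simp only [true_and]
  convert (h1 x).trans (h2 x').symm

theorem twoK4_isNClique_three : twoK4.IsNClique 3 {0, 1, 2} := by decide
theorem twoK4_isNClique_four : twoK4.IsNClique 4 {0, 1, 2, 3} := by decide

theorem moebiusLadder_cliqueFree : moebiusLadder.CliqueFree 3 := by
  have h : ∀ a b c, moebiusLadder.Adj a b → moebiusLadder.Adj a c → ¬ moebiusLadder.Adj b c := by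
    decide
  intro s hs
  obtain ⟨a, b, c, hab, hac, hbc, -⟩ := SimpleGraph.is3Clique_iff.mp hs
  exact h a b c hab hac hbc

theorem rookGraph_isSRGWith : rookGraph.IsSRGWith 16 6 2 2 where
  card := rfl
  regular := by
    have h : ∀ a, rookGraph.degree a = 6 := by decide +kernel
    exact h
  of_adj := by decide +kernel
  of_not_adj := by
    have h : ∀ a b, a ≠ b → ¬ rookGraph.Adj a b →
      Fintype.card (rookGraph.commonNeighbors a b) = 2 := by decide +kernel
    exact fun a b => h a b

theorem shrikhandeGraph_isSRGWith : shrikhandeGraph.IsSRGWith 16 6 2 2 where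
  card := rfl
  regular := by
    have h : ∀ a, shrikhandeGraph.degree a = 6 := by decide +kernel
    exact h
  of_adj := by decide +kernel
  of_not_adj := by
    have h : ∀ a b, a ≠ b → ¬ shrikhandeGraph.Adj a b →
      Fintype.card (shrikhandeGraph.commonNeighbors a b) = 2 := by decide +kernel
    exact fun a b => h a b

theorem rookGraph_isNClique : rookGraph.IsNClique 4 {(0, 0), (0, 1), (0, 2), (0, 3)} := by decide

theorem shrikhandeGraph_cliqueFree : shrikhandeGraph.CliqueFree 4 := by
  -- By translation one vertex of the clique can be taken to be `0`, whose neighbours form a cycle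
  -- of length 6.
  have h : ∀ x y z : ZMod 4 × ZMod 4, shrikhandeGraph.Adj 0 x → shrikhandeGraph.Adj 0 y →
      shrikhandeGraph.Adj 0 z → shrikhandeGraph.Adj x y → shrikhandeGraph.Adj x z →
      ¬ shrikhandeGraph.Adj y z := by decide +kernel
  have hsub : ∀ a x y, shrikhandeGraph.Adj x y → shrikhandeGraph.Adj (x - a) (y - a) := by
    intro a x y hxy
    simpa [shrikhandeGraph] using hxy
  intro s hs
  obtain ⟨a, ha⟩ : s.Nonempty := Finset.card_pos.mp (by rw [hs.card_eq]; norm_num)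
  obtain ⟨b, c, d, hbc, hbd, hcd, hbcd⟩ := SimpleGraph.is3Clique_iff.mp (hs.erase_of_mem ha)
  have hadj : ∀ x ∈ ({b, c, d} : Finset _), shrikhandeGraph.Adj a x := fun x hx => by
    rw [← hbcd, Finset.mem_erase] at hx
    exact hs.isClique ha hx.2 hx.1.symm
  have h0 : ∀ x, shrikhandeGraph.Adj a x → shrikhandeGraph.Adj 0 (x - a) := fun x hx => by
    simpa using hsub a a x hx
  exact h _ _ _ (h0 b (hadj b (by simp))) (h0 c (hadj c (by simp)))
    (h0 d (hadj d (by simp))) (hsub a _ _ hbc)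
    (hsub a _ _ hbd) (hsub a _ _ hcd)

theorem isEmpty_rookGraph_iso_shrikhandeGraph : IsEmpty (rookGraph ≃g shrikhandeGraph) :=
  ⟨fun e => shrikhandeGraph_cliqueFree _ (rookGraph_isNClique.map
    (f := e.toEmbedding.toEmbedding) |>.mono
    (SimpleGraph.map_le_iff_le_comap _ _ _ |>.mpr fun _ _ h => e.map_adj_iff.mpr h))⟩

theorem proposition1 :
    -- PG-GNNs simulate GINs
    (∀ (d e : ℕ) (gin : GIN e d), PGSimulates PGForm.merged gin) ∧
    (∀ (d e : ℕ) (gin : GIN e d), gin.IsAffine → PGSimulates PGForm.separate gin) ∧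
    -- PG-GNNs count incidence triangles and incidence 4-cliques at every node
    (∀ (F : PGForm) (V : Type) [Fintype V],
      ∃ net : PGGNN F 2 (Fintype.card V + 1),
        ∀ (G : SimpleGraph V) (ν : NbrNumbering G) (ident : V ≃ Fin (Fintype.card V)) (v : V),
          net.nodeScore ν (identifiedInput G ident) v =
            ![(incidenceCliques G 3 v : ℝ), (incidenceCliques G 4 v : ℝ)]) ∧
    -- 2-WL counts neither
    ¬ WLCanCount 2 (fun _ G => ∑ v, incidenceCliques G 3 v) ∧
    ¬ WLCanCount 2 (fun _ G => ∑ v, incidenceCliques G 4 v) ∧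
    -- PG-GNN is strictly more powerful than 2-WL
    (∀ F : PGForm,
      (∀ (V : Type) [Fintype V] (G G' : SimpleGraph V),
        WLDistinguishes 2 G G' → PGDistinguishes F G G' ∧ PGDistinguishesAnonymous F G G') ∧
      (∃ (N : ℕ) (G G' : SimpleGraph (Fin N)),
        PGDistinguishes F G G' ∧ ¬ WLDistinguishes 2 G G')) ∧
    -- PG-GNN is not less powerful than 3-WL
    rookGraph.IsSRGWith 16 6 2 2 ∧ shrikhandeGraph.IsSRGWith 16 6 2 2 ∧
    IsEmpty (rookGraph ≃g shrikhandeGraph) ∧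
    (∀ F : PGForm, PGDistinguishes F rookGraph shrikhandeGraph) ∧
    ¬ WLDistinguishes 3 rookGraph shrikhandeGraph := by
  have h3 : ∑ v, incidenceCliques twoK4 3 v ≠ ∑ v, incidenceCliques moebiusLadder 3 v := by
    rw [sum_incidenceCliques_eq_zero moebiusLadder_cliqueFree]
    exact (sum_incidenceCliques_pos twoK4_isNClique_three (v := 0) (by simp)).ne'
  have h4 : ∑ v, incidenceCliques twoK4 4 v ≠ ∑ v, incidenceCliques moebiusLadder 4 v := by
    rw [sum_incidenceCliques_eq_zero (moebiusLadder_cliqueFree.mono (by norm_num))]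
    exact (sum_incidenceCliques_pos twoK4_isNClique_four (v := 0) (by simp)).ne'
  have h4' : ∑ v, incidenceCliques rookGraph 4 v ≠ ∑ v, incidenceCliques shrikhandeGraph 4 v := by
    rw [sum_incidenceCliques_eq_zero shrikhandeGraph_cliqueFree]
    exact (sum_incidenceCliques_pos rookGraph_isNClique (v := (0, 0)) (by simp)).ne'
  refine ⟨fun d e gin => Simulable.pgSimulates fun N => Simulable.gin_merged gin,
    fun d e gin hgin => Simulable.pgSimulates fun N => Simulable.gin_separate gin hgin,
    fun F V _ => ?_, fun h => not_WLDistinguishes_twoK4_moebiusLadder (h 8 _ _ h3),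
    fun h => not_WLDistinguishes_twoK4_moebiusLadder (h 8 _ _ h4),
    fun F => ⟨fun V _ G G' h => Refinement.distinguishes_of_WLDistinguishes_two h,
      8, twoK4, moebiusLadder, CliqueNet.distinguishes h4,
      not_WLDistinguishes_twoK4_moebiusLadder⟩,
    rookGraph_isSRGWith, shrikhandeGraph_isSRGWith, isEmpty_rookGraph_iso_shrikhandeGraph,
    fun F => CliqueNet.distinguishes h4',
    not_WLDistinguishes_three_of_isSRGWith rookGraph_isSRGWith shrikhandeGraph_isSRGWith⟩
  obtain ⟨net, hnet⟩ := (CliqueNet.realizes_cliques (F := F) (V := V)).exists_net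
  exact ⟨net, fun G ν ident => hnet G ν _ ⟨ident, rfl⟩⟩
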